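/- All logarithms are base $2$ and all graphs are finite and simple. A graph is $d$-degenerate if every nonempty subgraph of it has a vertex of degree at most $d$ (in that subgraph). A graph $G=(V,E)$ is $(p,\lambda)$-pseudo-random if $\left|d(A,B)-p\right|\le \lambda/\sqrt{|A||B|}$ for all nonempty $A,B\subseteq V$, where $d(A,B)=e(A,B)/(|A||B|)$ and $e(A,B)$ is the number of pairs $(a,b)\in A\times B$ such that $ab\in E$. In a $2$-edge-colouring of $G$, an induced monochromatic copy of $H$ in a given colour is an induced subgraph of $G$ that is isomorphic to $H$ and all of whose edges have that colour. The induced Ramsey number $r_{\mathrm{ind}}(H)$ is the minimum $n$ for which there is a graph on $n$ vertices that contains an induced monochromatic copy of $H$ in each of its $2$-edge-colourings. (1) There is an absolute constant $c>0$ such that for all integers $k,d,\chi\ge 2$ and every $(\frac1k,n^{0.9})$-pseudo-random graph $G$ on $n\ge k^{cd\log\chi}$ vertices the following holds: for every $2$-edge-colouring of $G$ there is one colour such that every $d$-degenerate graph on $k$ vertices with chromatic number at most $\chi$ occurs in $G$ as an induced monochromatic copy in that colour. (2) There is an absolute constant $c>0$ such that every $d$-degenerate graph $H$ on $k$ vertices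 with chromatic number $\chi\ge 2$ has a (finite) induced Ramsey number, and $r_{\mathrm{ind}}(H)\le k^{cd\log\chi}$. (3) In particular, for every integer $d\ge 0$ there is an integer $m\ge 0$ such that every $d$-degenerate graph $H$ on $k$ vertices has a (finite) induced Ramsey number, and $r_{\mathrm{ind}}(H)\le k^{m}$. -/

import Mathlib

universe u v

/-- A graph is `d`-degenerate if every (nonempty) subgraph of it has a vertex whose degree in
that subgraph is at most `d`. -/
def IsDegenerate {W : Type v} (H : SimpleGraph W) (d : ℕ) : Prop :=
  ∀ S : H.Subgraph, S.verts.Nonempty → ∃ w ∈ S.verts, (S.neighborSet w).encard ≤ d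

open Classical in
/-- A graph is `(p, lam)`-pseudo-random if `|d(A, B) - p| ≤ lam / √(|A| |B|)` for all nonempty
(not necessarily disjoint) vertex subsets `A`, `B`, where `d(A, B) = e(A, B) / (|A| |B|)` and
`e(A, B)` is the number of pairs `(a, b) ∈ A × B` with `a` adjacent to `b`. -/
def IsPseudoRandom {V : Type u} (G : SimpleGraph V) (p lam : ℝ) : Prop :=
  ∀ A B : Finset V, A.Nonempty → B.Nonempty →
    |(G.edgeDensity A B : ℝ) - p| ≤ lam / √((A.card : ℝ) * (B.card : ℝ))

/-- In the 2-edge-colouring `C` of `G` there is an induced copy of `H` all of whose edges have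
colour `i`. -/
def HasInducedCopyInColor {V : Type u} {W : Type v} (G : SimpleGraph V) (C : G.EdgeLabeling (Fin 2))
    (i : Fin 2) (H : SimpleGraph W) : Prop :=
  ∃ f : H ↪g G, ∀ a b : W, H.Adj a b → (C.labelGraph i).Adj (f a) (f b)

/-- The set of all `n` such that some graph `G` on `n` vertices has an induced monochromatic copy
of `H` in each of its 2-edge-colourings. -/
def inducedRamseySet {W : Type v} (H : SimpleGraph W) : Set ℕ :=
  {n | ∃ G : SimpleGraph (Fin n), ∀ C : G.EdgeLabeling (Fin 2),
    ∃ i : Fin 2, HasInducedCopyInColor G C i H}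

/-- The induced Ramsey number of `H`: the least element of `inducedRamseySet H`
(with the usual value `0` if that set is empty). -/
noncomputable def inducedRamseyNumber {W : Type v} (H : SimpleGraph W) : ℕ :=
  sInf (inducedRamseySet H)

/-! Put x = 1/k and call colours 0 and 1 red and blue. Order the vertices of H so that each has at
most d earlier neighbours (`IsDegenerate.exists_equiv`) and embed them greedily, every vertex not
yet embedded keeping a set of candidates. A non-edge of H shrinks a candidate set by a factor close
to 1 - x, which over k steps costs only a power of k; an edge shrinks it by a small factor α, but at
most d times. So candidate sets keep a k^(-O(d)) fraction of their size, and pseudo-randomness of G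
remains usable.

The colour is fixed before H is known, by a dichotomy (`exists_color_of_isUniformRel`). Suppose some
large set U has red density at least α between any two of its large subsets. Then greedy embedding
inside U works in red: few vertices are bad for each candidate set (`exists_compatible_of_dense`).

Otherwise every large set contains two large subsets of red density below α. Iterating t times gives
2^t large sets that are pairwise sparse in red (`exists_sparse_family`), and the colour classes of H
are placed in different sets; 2^t is about the chromatic number, whence the exponent d log χ.
Sparseness need not pass to small subsets, so blue embedding is steered by a potential, the sum of
red densities over the edges of H not yet embedded. Averaging over the next image, using that
codegrees in G are as expected, gives a vertex for which the potential grows by a factor at most 1 +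
x (`exists_nextCand_bounds`). Over k steps it stays below 4 x^12, so hardly any candidate is lost to
red edges (`exists_compatible_of_sparse`).

For the Ramsey number bounds, a pseudo-random graph of density about 1/k is built from point-line
incidences over a prime field (`exists_isPseudoRandom`), and Bertrand's postulate supplies a prime
of the right size. -/

/-! ### Degenerate orderings and colourings. -/

section Degenerate

open Finset
open scoped Classical

variable {W : Type*} {H : SimpleGraph W} {d : ℕ}

theorem IsDegenerate.mono {d' : ℕ} (h : IsDegenerate H d) (hd : d ≤ d') : IsDegenerate H d' := by
  intro S hS
  obtain ⟨w, hw, hle⟩ := h S hS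
  exact ⟨w, hw, hle.trans (by exact_mod_cast hd)⟩

theorem IsDegenerate.exists_card_adj_le (h : IsDegenerate H d) (S : Finset W) (hS : S.Nonempty) :
    ∃ w ∈ S, #{x ∈ S | H.Adj w x} ≤ d := by
  obtain ⟨w, hw, hle⟩ := h ((⊤ : H.Subgraph).induce S) (by simpa using hS)
  have hw' : w ∈ S := by simpa using hw
  refine ⟨w, hw', ?_⟩
  have : (((⊤ : H.Subgraph).induce S).neighborSet w) = ({x ∈ S | H.Adj w x} : Finset W) := by
    ext x
    simp [hw']
  rw [this, Set.encard_coe_eq_coe_finsetCard] at hle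
  exact_mod_cast hle

/-- Remove a vertex of degree at most d, order the rest by induction, and put the removed vertex
last. -/
theorem IsDegenerate.exists_order (h : IsDegenerate H d) (S : Finset W) :
    ∃ o : W → ℕ, (∀ w ∈ S, o w < #S) ∧ Set.InjOn o S ∧
      ∀ w ∈ S, #{x ∈ S | H.Adj w x ∧ o x < o w} ≤ d := by
  induction hn : #S generalizing S with
  | zero => exact ⟨fun _ => 0, by simp_all [Finset.card_eq_zero]⟩
  | succ n ih =>
    have hS : S.Nonempty := by rw [← Finset.card_pos]; omega
    obtain ⟨w, hw, hle⟩ := h.exists_card_adj_le S hS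
    obtain ⟨o, h1, h2, h3⟩ := ih (S.erase w) (by rw [card_erase_of_mem hw]; omega)
    refine ⟨Function.update o w n, ?_, ?_, ?_⟩
    · intro x hx
      by_cases hxw : x = w
      · subst hxw; simp
      · have := h1 x (by simp [hxw, hx])
        simp [hxw]; omega
    · intro x hx y hy hxy
      by_cases hxw : x = w <;> by_cases hyw : y = w
      · rw [hxw, hyw]
      · have := h1 y (by simp_all)
        simp_all
      · have := h1 x (by simp_all)
        simp_all
      · simp only [Function.update_of_ne hxw, Function.update_of_ne hyw] at hxy
        exact h2 (by simp_all) (by simp_all) hxy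
    · intro x hx
      by_cases hxw : x = w
      · subst hxw
        exact (card_le_card (by intro y; simp +contextual)).trans hle
      · refine (card_le_card ?_).trans (h3 x (by simp [hxw, hx]))
        intro y
        simp only [mem_filter, mem_erase, Function.update_of_ne hxw]
        rintro ⟨hy, hadj, hlt⟩
        have hyw : y ≠ w := by
          rintro rfl
          have := h1 x (by simp [hxw, hx])
          simp at hlt; omega
        rw [Function.update_of_ne hyw] at hlt
        exact ⟨⟨hyw, hy⟩, hadj, hlt⟩

theorem IsDegenerate.exists_equiv [Fintype W] (h : IsDegenerate H d) {k : ℕ}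
    (hk : Fintype.card W = k) :
    ∃ e : W ≃ Fin k, ∀ i : Fin k, #{j | j < i ∧ H.Adj (e.symm j) (e.symm i)} ≤ d := by
  obtain ⟨o, h1, h2, h3⟩ := h.exists_order univ
  subst hk
  let g : W → Fin (Fintype.card W) := fun w => ⟨o w, h1 w (mem_univ w)⟩
  have hg : Function.Bijective g := by
    rw [Fintype.bijective_iff_injective_and_card]
    refine ⟨fun x y hxy => h2 (by simp) (by simp) ?_, by simp⟩
    exact congrArg Fin.val hxy
  refine ⟨Equiv.ofBijective g hg, fun i => ?_⟩
  obtain ⟨w, rfl⟩ := (Equiv.ofBijective g hg).surjective i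
  refine le_trans ?_ (h3 w (mem_univ w))
  refine card_le_card_of_injOn (Equiv.ofBijective g hg).symm ?_
    (Equiv.ofBijective g hg).symm.injective.injOn
  intro j hj
  obtain ⟨x, rfl⟩ := (Equiv.ofBijective g hg).surjective j
  have hj : g x < g w ∧ H.Adj x w := by simpa using hj
  simpa using ⟨hj.2.symm, hj.1⟩

/-- Greedy colouring in a degenerate order. It turns a bound on d into one on the chromatic number
when only d is given. -/
theorem IsDegenerate.colorable [Fintype W] (h : IsDegenerate H d) : H.Colorable (d + 1) := by
  suffices hS : ∀ S : Finset W, ∃ c : W → Fin (d + 1),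
      ∀ x ∈ S, ∀ y ∈ S, H.Adj x y → c x ≠ c y by
    obtain ⟨c, hc⟩ := hS univ
    exact ⟨SimpleGraph.Coloring.mk c fun {x y} hxy => hc x (by simp) y (by simp) hxy⟩
  intro S
  induction hn : #S generalizing S with
  | zero => exact ⟨fun _ => 0, by simp_all [Finset.card_eq_zero]⟩
  | succ n ih =>
    have hS : S.Nonempty := by rw [← Finset.card_pos]; omega
    obtain ⟨w, hw, hle⟩ := h.exists_card_adj_le S hS
    obtain ⟨c, hc⟩ := ih (S.erase w) (by rw [card_erase_of_mem hw]; omega)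
    obtain ⟨a, ha⟩ : ∃ a : Fin (d + 1), a ∉ image c {x ∈ S | H.Adj w x} := by
      by_contra! hcon
      have h1 := card_le_card (fun x _ => hcon x : univ ⊆ image c {x ∈ S | H.Adj w x})
      have h2 := card_image_le (s := {x ∈ S | H.Adj w x}) (f := c)
      simp at h1; omega
    refine ⟨Function.update c w a, fun x hx y hy hxy => ?_⟩
    by_cases hxw : x = w <;> by_cases hyw : y = w
    · subst hxw; subst hyw; simp at hxy
    · subst hxw
      simp only [Function.update_self, Function.update_of_ne hyw]
      rintro rfl
      exact ha (mem_image_of_mem c (by simp [hy, hxy]))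
    · subst hyw
      simp only [Function.update_self, Function.update_of_ne hxw]
      rintro rfl
      exact ha (mem_image_of_mem c (by simp [hx, hxy.symm]))
    · simp only [Function.update_of_ne hxw, Function.update_of_ne hyw]
      exact hc x (by simp_all) y (by simp_all) hxy

end Degenerate

/-! ### Greedy embedding with candidate sets. -/

section Greedy

open Finset
open scoped Classical

variable {V : Type*}

/-- `x` may be the image of `b` once `v` is the image of `a`: neighbours go to `R`-neighbours,
non-neighbours to distinct non-neighbours. -/
def Compatible {k : ℕ} (H : SimpleGraph (Fin k)) (G : SimpleGraph V) (R : V → V → Prop)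
    (a b : Fin k) (v x : V) : Prop :=
  (H.Adj a b → R v x) ∧ (¬ H.Adj a b → ¬ G.Adj v x ∧ x ≠ v)

/-- The bookkeeping shared by the red and the blue embedding: `Inv` is whatever property of the
candidate sets keeps the process alive, and `R` is the relation wanted on edges. -/
theorem exists_map_of_greedy {k : ℕ} (H : SimpleGraph (Fin k)) (G : SimpleGraph V)
    (R : V → V → Prop) (Inv : ℕ → (Fin k → Finset V) → Prop) (C₀ : Fin k → Finset V)
    (h₀ : Inv 0 C₀)
    (step : ∀ (i : Fin k) (C : Fin k → Finset V), Inv i C → ∃ v ∈ C i, ∃ C' : Fin k → Finset V,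
      Inv (i + 1) C' ∧ ∀ h, i < h → C' h ⊆ C h ∧ ∀ x ∈ C' h, Compatible H G R i h v x) :
    ∃ f : Fin k → V, ∀ a b, a < b → Compatible H G R a b (f a) (f b) := by
  rcases Nat.eq_zero_or_pos k with rfl | hk
  · exact ⟨fun a => a.elim0, fun a => a.elim0⟩
  have : Nonempty V := by
    obtain ⟨v, -⟩ := step ⟨0, hk⟩ C₀ h₀
    exact ⟨v⟩
  have main : ∀ i ≤ k, ∃ (C : Fin k → Finset V) (f : Fin k → V), Inv i C ∧
      (∀ a b : Fin k, a < b → (b : ℕ) < i → Compatible H G R a b (f a) (f b)) ∧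
      ∀ a b : Fin k, (a : ℕ) < i → i ≤ (b : ℕ) → ∀ x ∈ C b, Compatible H G R a b (f a) x := by
    intro i
    induction i with
    | zero => exact fun _ => ⟨C₀, fun _ => Classical.arbitrary V, h₀, by simp, by simp⟩
    | succ i ih =>
      intro hi
      obtain ⟨C, f, hInv, h1, h2⟩ := ih (by omega)
      obtain ⟨v, hv, C', hInv', hC'⟩ := step ⟨i, hi⟩ C hInv
      refine ⟨C', Function.update f ⟨i, hi⟩ v, hInv', ?_, ?_⟩
      · intro a b hab hb
        have ha : a ≠ ⟨i, hi⟩ := by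
          rintro rfl
          have : i < (b : ℕ) := hab
          omega
        rw [Function.update_of_ne ha]
        by_cases hbi : b = ⟨i, hi⟩
        · subst hbi
          rw [Function.update_self]
          exact h2 a _ hab le_rfl v hv
        · rw [Function.update_of_ne hbi]
          refine h1 a b hab ?_
          have : (b : ℕ) ≠ i := fun h => hbi (Fin.ext h)
          omega
      · intro a b ha hb x hx
        have hib : (⟨i, hi⟩ : Fin k) < b := by
          rw [Fin.lt_def]; exact hb
        by_cases hai : a = ⟨i, hi⟩
        · subst hai
          rw [Function.update_self]
          exact (hC' b hib).2 x hx
        · rw [Function.update_of_ne hai]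
          have : (a : ℕ) ≠ i := fun h => hai (Fin.ext h)
          exact h2 a b (by omega) (by omega) x ((hC' b hib).1 hx)
  obtain ⟨C, f, -, h, -⟩ := main k le_rfl
  exact ⟨f, fun a b hab => h a b hab b.2⟩

/-- Injectivity is not assumed: adjacent vertices have distinct images since G has no loops,
non-adjacent ones by the clause `x ≠ v` in `Compatible`. -/
theorem hasInducedCopyInColor_of_compatible {W : Type*} {k : ℕ} (H : SimpleGraph W)
    (G : SimpleGraph V) (C : G.EdgeLabeling (Fin 2)) (c : Fin 2) (e : W ≃ Fin k) (f : Fin k → V)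
    (hf : ∀ a b, a < b →
      Compatible (H.comap e.symm) G (C.labelGraph c).Adj a b (f a) (f b)) :
    HasInducedCopyInColor G C c H := by
  have key : ∀ a b : Fin k, a ≠ b → ((H.comap e.symm).Adj a b → (C.labelGraph c).Adj (f a) (f b)) ∧
      (¬ (H.comap e.symm).Adj a b → ¬ G.Adj (f a) (f b) ∧ f b ≠ f a) := by
    intro a b hab
    rcases lt_or_gt_of_ne hab with h | h
    · exact hf a b h
    · have := hf b a h
      refine ⟨fun h1 => (this.1 h1.symm).symm, fun h1 => ?_⟩
      have h2 := this.2 (fun h3 => h1 h3.symm)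
      exact ⟨fun h3 => h2.1 h3.symm, h2.2.symm⟩
  have hle : ∀ x y, (C.labelGraph c).Adj x y → G.Adj x y :=
    fun x y h => SimpleGraph.EdgeLabeling.labelGraph_le C h
  have hinj : Function.Injective f := by
    intro a b hab
    by_contra hne
    have h1 := key a b hne
    by_cases h : (H.comap e.symm).Adj a b
    · have := hle _ _ (h1.1 h)
      rw [hab] at this
      exact G.irrefl this
    · exact (h1.2 h).2 hab.symm
  have hadj : ∀ a b : W, H.Adj a b → (C.labelGraph c).Adj (f (e a)) (f (e b)) := by
    intro a b hab
    refine (key (e a) (e b) ?_).1 (by simpa using hab)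
    intro h
    rw [e.injective h] at hab
    exact H.irrefl hab
  refine ⟨⟨⟨fun w => f (e w), fun a b hab => e.injective (hinj hab)⟩, ?_⟩, hadj⟩
  intro a b
  refine ⟨fun h => ?_, fun h => hle _ _ (hadj a b h)⟩
  by_contra hn
  have hne : e a ≠ e b := by
    intro h'
    rw [e.injective h'] at h
    exact G.irrefl h
  exact ((key (e a) (e b) hne).2 (by simpa using hn)).1 h

end Greedy

/-! ### Uniform relations, exceptional vertices and averaging over neighbourhoods. -/

section Uniform

open Finset
open scoped Classical

variable {V : Type*}

/-- The number of `r`-successors of `v` in `B`. -/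
noncomputable def relDeg (r : V → V → Prop) (v : V) (B : Finset V) : ℝ :=
  (#{x ∈ B | r v x} : ℝ)

/-- The number of pairs in `A × B` related by `r`. -/
noncomputable def relSum (r : V → V → Prop) (A B : Finset V) : ℝ :=
  ∑ v ∈ A, relDeg r v B

/-- All pairs of sets of size at least `M` have `r`-density `w ± δ`. -/
def IsUniformRel (r : V → V → Prop) (w δ M : ℝ) : Prop :=
  ∀ A B : Finset V, M ≤ #A → M ≤ #B → |relSum r A B - w * #A * #B| ≤ δ * #A * #B

variable {r : V → V → Prop} {w δ M : ℝ} {A B C : Finset V}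

theorem relDeg_nonneg (v : V) : 0 ≤ relDeg r v B := Nat.cast_nonneg _

theorem relSum_nonneg : 0 ≤ relSum r A B := Finset.sum_nonneg fun v _ => relDeg_nonneg v

theorem relDeg_le_card (v : V) : relDeg r v B ≤ #B := by
  unfold relDeg
  exact_mod_cast card_filter_le _ _

theorem relDeg_mono {B' : Finset V} (h : B ⊆ B') (v : V) : relDeg r v B ≤ relDeg r v B' := by
  unfold relDeg
  exact_mod_cast card_le_card (filter_subset_filter _ h)

theorem relSum_mono {A' B' : Finset V} (hA : A ⊆ A') (hB : B ⊆ B') :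
    relSum r A B ≤ relSum r A' B' :=
  (Finset.sum_le_sum fun v _ => relDeg_mono hB v).trans
    (Finset.sum_le_sum_of_subset_of_nonneg hA fun v _ _ => relDeg_nonneg v)

theorem relDeg_eq_sum (v : V) : relDeg r v B = ∑ x ∈ B, if r v x then (1 : ℝ) else 0 := by
  simp [relDeg]

theorem relDeg_not (v : V) : relDeg (fun x y => ¬ r x y) v B = #B - relDeg r v B := by
  have := card_filter_add_card_filter_not (s := B) (r v)
  simp only [relDeg]
  rw [← this]
  push_cast
  ring

theorem relSum_comm (hr : ∀ x y, r x y ↔ r y x) : relSum r A B = relSum r B A := by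
  simp only [relSum, relDeg_eq_sum]
  rw [Finset.sum_comm]
  simp only [hr]

theorem relSum_eq_card_interedges : relSum r A B = #(Rel.interedges r A B) := by
  simp only [relSum, relDeg_eq_sum, Rel.interedges]
  rw [← Finset.sum_product']
  simp

theorem IsUniformRel.not (h : IsUniformRel r w δ M) :
    IsUniformRel (fun x y => ¬ r x y) (1 - w) δ M := by
  intro A B hA hB
  have h1 := h A B hA hB
  have : relSum (fun x y => ¬ r x y) A B = #A * #B - relSum r A B := by
    simp [relSum, relDeg_not, Finset.sum_sub_distrib]
  rw [this, ← abs_neg]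
  convert h1 using 2
  ring

/-- If there were M such vertices, they and B would form a pair violating uniformity. -/
theorem IsUniformRel.card_low_lt (h : IsUniformRel r w δ M) (hM : 0 < M) (hB : M ≤ #B) :
    (#{v ∈ A | relDeg r v B < (w - δ) * #B} : ℝ) < M := by
  by_contra! hcon
  set S := {v ∈ A | relDeg r v B < (w - δ) * #B} with hS
  have h1 := (abs_le.1 (h S B hcon hB)).1
  have hne : S.Nonempty := by
    rw [← Finset.card_pos]; exact_mod_cast hM.trans_le hcon
  have h2 : relSum r S B < ∑ _v ∈ S, (w - δ) * #B :=
    Finset.sum_lt_sum_of_nonempty hne fun v hv => (mem_filter.1 hv).2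
  rw [sum_const, nsmul_eq_mul] at h2
  linarith

theorem IsUniformRel.card_high_lt (h : IsUniformRel r w δ M) (hM : 0 < M) (hB : M ≤ #B) :
    (#{v ∈ A | (w + δ) * #B < relDeg r v B} : ℝ) < M := by
  by_contra! hcon
  set S := {v ∈ A | (w + δ) * #B < relDeg r v B} with hS
  have h1 := (abs_le.1 (h S B hcon hB)).2
  have hne : S.Nonempty := by
    rw [← Finset.card_pos]; exact_mod_cast hM.trans_le hcon
  have h2 : ∑ _v ∈ S, (w + δ) * #B < relSum r S B :=
    Finset.sum_lt_sum_of_nonempty hne fun v hv => (mem_filter.1 hv).2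
  rw [sum_const, nsmul_eq_mul] at h2
  linarith

theorem IsPseudoRandom.isUniformRel {G : SimpleGraph V} {p lam : ℝ} (h : IsPseudoRandom G p lam)
    (hδ : 0 ≤ δ) (hM : 0 < M) (hlam : lam ≤ δ * M) : IsUniformRel G.Adj p δ M := by
  intro A B hA hB
  have hA0 : (0 : ℝ) < #A := hM.trans_le hA
  have hB0 : (0 : ℝ) < #B := hM.trans_le hB
  have h1 := h A B (Finset.card_pos.1 (by exact_mod_cast hA0))
    (Finset.card_pos.1 (by exact_mod_cast hB0))
  have hs : M ≤ √((#A : ℝ) * #B) := by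
    apply Real.le_sqrt_of_sq_le
    rw [sq]
    exact mul_le_mul hA hB hM.le hA0.le
  have h2 : |(G.edgeDensity A B : ℝ) - p| ≤ δ := by
    refine h1.trans ?_
    rw [div_le_iff₀ (hM.trans_le hs)]
    exact hlam.trans (mul_le_mul_of_nonneg_left hs hδ)
  have h3 : relSum G.Adj A B = (G.edgeDensity A B : ℝ) * #A * #B := by
    rw [relSum_eq_card_interedges, SimpleGraph.edgeDensity_def]
    push_cast
    rw [mul_assoc, div_mul_cancel₀ _ (by positivity)]
    rfl
  have h4 : relSum G.Adj A B - p * #A * #B = ((G.edgeDensity A B : ℝ) - p) * (#A * #B) := by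
    rw [h3]; ring
  rw [h4, abs_mul, abs_of_pos (mul_pos hA0 hB0), mul_assoc]
  exact mul_le_mul_of_nonneg_right h2 (by positivity)

/-- Random restriction to neighbourhoods does not increase the expected number of `R`-pairs by more
than expected. -/
theorem sum_relSum_filter_le {r₁ r₂ : V → V → Prop} (R : V → V → Prop) {w₁ w₂ : ℝ}
    (h₁ : IsUniformRel r₁ w₁ δ M) (h₂ : IsUniformRel r₂ w₂ δ M)
    (hs₁ : ∀ x y, r₁ x y ↔ r₁ y x) (hs₂ : ∀ x y, r₂ x y ↔ r₂ y x)
    (hM : 0 < M) (hw₂ : 0 ≤ w₂ + δ) (hC : M ≤ #C)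
    (hMC : M ≤ (w₁ + δ) * (w₂ + δ) * #C) :
    ∑ v ∈ C, relSum R {x ∈ A | r₁ v x} {y ∈ B | r₂ v y} ≤
      (w₁ + δ) * (w₂ + δ) * #C * relSum R A B + M * (#A + #B) * #C := by
  set Q := (w₁ + δ) * (w₂ + δ) * #C with hQ
  have hQ0 : 0 < Q := hM.trans_le hMC
  -- Double counting: an `R`-pair (x, y) survives the restriction at v exactly when v is a common
  -- neighbour of x and y, so codegrees in C are what must be bounded.
  have hswap : ∑ v ∈ C, relSum R {x ∈ A | r₁ v x} {y ∈ B | r₂ v y} =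
      ∑ x ∈ A, ∑ y ∈ B with R x y, relDeg r₂ y {v ∈ C | r₁ x v} := by
    simp only [relSum, relDeg_eq_sum, sum_filter]
    rw [Finset.sum_comm]
    refine sum_congr rfl fun x _ => ?_
    simp only [← ite_and]
    have : ∀ v, (if r₁ v x then ∑ a ∈ B, (if r₂ v a ∧ R x a then (1 : ℝ) else 0) else 0) =
        ∑ a ∈ B, if r₁ v x ∧ r₂ v a ∧ R x a then (1 : ℝ) else 0 := by
      intro v; split_ifs with h <;> simp [h]
    simp only [this]
    rw [Finset.sum_comm]
    refine sum_congr rfl fun y _ => ?_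
    by_cases h : R x y
    · simp [h, hs₁ _ x, hs₂ _ y]
    · simp [h]
  -- Fewer than M vertices x have too large a degree into C; each costs at most |B||C|. For any
  -- other x, fewer than M vertices y have too large a degree into the neighbourhood D of x, costing
  -- at most |C| each. If D itself is smaller than M, then M ≤ Q already suffices.
  have hpoint : ∀ x ∈ A, ∑ y ∈ B with R x y, relDeg r₂ y {v ∈ C | r₁ x v} ≤
      Q * relDeg R x B + M * #C +
        if (w₁ + δ) * #C < relDeg r₁ x C then (#B : ℝ) * #C else 0 := by
    intro x _
    set D := {v ∈ C | r₁ x v} with hD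
    have hDC : (#D : ℝ) ≤ #C := by exact_mod_cast card_filter_le _ _
    split_ifs with hbad
    · have : ∑ y ∈ B with R x y, relDeg r₂ y D ≤ ∑ y ∈ B with R x y, (#C : ℝ) :=
        sum_le_sum fun y _ => (relDeg_le_card y).trans hDC
      rw [sum_const, nsmul_eq_mul] at this
      have h4 : (#{y ∈ B | R x y} : ℝ) ≤ #B := by exact_mod_cast card_filter_le _ _
      have h5 := mul_le_mul_of_nonneg_right h4 (Nat.cast_nonneg (α := ℝ) #C)
      have h6 := mul_nonneg hQ0.le (relDeg_nonneg (r := R) (B := B) x)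
      have h7 := mul_nonneg hM.le (Nat.cast_nonneg (α := ℝ) #C)
      linarith
    · have hDle : (#D : ℝ) ≤ (w₁ + δ) * #C := not_lt.1 hbad
      rw [add_zero]
      by_cases hDM : M ≤ #D
      · have hy : ∀ y ∈ ({y ∈ B | R x y} : Finset V), relDeg r₂ y D ≤
            Q + if (w₂ + δ) * #D < relDeg r₂ y D then (#C : ℝ) else 0 := by
          intro y _
          split_ifs with hb
          · have := (relDeg_le_card (r := r₂) (B := D) y).trans hDC
            linarith
          · have := mul_le_mul_of_nonneg_left hDle hw₂
            have h8 := not_lt.1 hb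
            rw [hQ]
            linarith
        refine (sum_le_sum hy).trans ?_
        rw [sum_add_distrib, sum_const, nsmul_eq_mul, ← sum_filter, sum_const, nsmul_eq_mul]
        have h3 := (h₂.card_high_lt (A := {y ∈ B | R x y}) hM hDM).le
        have h4 := mul_le_mul_of_nonneg_right h3 (Nat.cast_nonneg (α := ℝ) #C)
        have h5 : (#{y ∈ B | R x y} : ℝ) = relDeg R x B := rfl
        rw [h5]
        linarith
      · have hy : ∀ y ∈ ({y ∈ B | R x y} : Finset V), relDeg r₂ y D ≤ Q := by
          intro y _
          exact ((relDeg_le_card y).trans (not_le.1 hDM).le).trans hMC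
        refine (sum_le_sum hy).trans ?_
        rw [sum_const, nsmul_eq_mul]
        have h5 : (#{y ∈ B | R x y} : ℝ) = relDeg R x B := rfl
        rw [h5]
        have h7 := mul_nonneg hM.le (Nat.cast_nonneg (α := ℝ) #C)
        linarith
  rw [hswap]
  refine (sum_le_sum hpoint).trans ?_
  rw [sum_add_distrib, sum_add_distrib, ← mul_sum, sum_const, nsmul_eq_mul, ← sum_filter,
    sum_const, nsmul_eq_mul]
  have h3 := (h₁.card_high_lt (A := A) hM hC).le
  have h4 := mul_le_mul_of_nonneg_right h3
    (mul_nonneg (Nat.cast_nonneg (α := ℝ) #B) (Nat.cast_nonneg (α := ℝ) #C))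
  have h5 : relSum R A B = ∑ x ∈ A, relDeg R x B := rfl
  rw [← h5]
  linarith

end Uniform

/-! ### Sizes of candidate sets; embedding in the dense case. -/

section Candidates

open Finset
open scoped Classical

variable {V : Type*} {k : ℕ}

/-- The number of neighbours of `h` among the first `i` vertices. -/
noncomputable def backDeg (H : SimpleGraph (Fin k)) (i : ℕ) (h : Fin k) : ℕ :=
  #{j : Fin k | (j : ℕ) < i ∧ H.Adj j h}

variable {H : SimpleGraph (Fin k)} {d : ℕ} {α β : ℝ}

theorem backDeg_zero (h : Fin k) : backDeg H 0 h = 0 := by simp [backDeg]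

theorem backDeg_succ_of_adj {i h : Fin k} (hadj : H.Adj i h) :
    backDeg H (i + 1) h = backDeg H i h + 1 := by
  have : univ.filter (fun j : Fin k => (j : ℕ) < i + 1 ∧ H.Adj j h) =
      insert i (univ.filter fun j : Fin k => (j : ℕ) < i ∧ H.Adj j h) := by
    ext j
    simp only [mem_filter, mem_univ, true_and, mem_insert, Nat.lt_succ_iff_lt_or_eq, Fin.ext_iff]
    constructor
    · rintro ⟨h1 | h1, h2⟩
      · exact Or.inr ⟨h1, h2⟩
      · exact Or.inl h1
    · rintro (h1 | ⟨h1, h2⟩)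
      · obtain rfl : j = i := Fin.ext h1
        exact ⟨Or.inr rfl, hadj⟩
      · exact ⟨Or.inl h1, h2⟩
  rw [backDeg, this, card_insert_of_notMem (by simp)]
  rfl

theorem backDeg_succ_of_not_adj {i h : Fin k} (hadj : ¬ H.Adj i h) :
    backDeg H (i + 1) h = backDeg H i h := by
  unfold backDeg
  congr 1
  ext j
  simp only [mem_filter, mem_univ, true_and, Nat.lt_succ_iff_lt_or_eq]
  constructor
  · rintro ⟨h1 | h1, h2⟩
    · exact ⟨h1, h2⟩
    · rw [Fin.ext h1] at h2; exact absurd h2 hadj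
  · rintro ⟨h1, h2⟩
    exact ⟨Or.inl h1, h2⟩

/-- A lower bound valid throughout the process: at most d factors α, since h has at most d earlier
neighbours, and at most k factors β. -/
theorem pow_mul_pow_le_backDeg (hα : 0 < α) (hα1 : α ≤ 1) (hβ : 0 < β) (hβ1 : β ≤ 1)
    (hd : ∀ i : Fin k, #{j | j < i ∧ H.Adj j i} ≤ d) {i : ℕ} {h : Fin k} (hi : i ≤ h) :
    α ^ d * β ^ k ≤ α ^ backDeg H i h * β ^ i := by
  have h1 : backDeg H i h ≤ d := by
    refine (card_le_card ?_).trans (hd h)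
    intro j
    simp only [mem_filter, mem_univ, true_and, Fin.lt_def]
    exact fun hj => ⟨by omega, hj.2⟩
  have h2 : i ≤ k := hi.trans h.2.le
  exact mul_le_mul (pow_le_pow_of_le_one hα.le hα1 h1) (pow_le_pow_of_le_one hβ.le hβ1 h2)
    (by positivity) (by positivity)

/-- An edge step is charged a superfluous factor β, so that the exponent of β is just the number of
steps. -/
theorem backDeg_bound_succ (hα : 0 < α) (hβ : 0 < β) (hβ1 : β ≤ 1) {i h : Fin k} {N s s' : ℝ}
    (hN : 0 ≤ N) (hs : α ^ backDeg H i h * β ^ (i : ℕ) * N ≤ s)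
    (h1 : H.Adj i h → α * s ≤ s') (h2 : ¬ H.Adj i h → β * s ≤ s') :
    α ^ backDeg H (i + 1) h * β ^ ((i : ℕ) + 1) * N ≤ s' := by
  by_cases hadj : H.Adj i h
  · rw [backDeg_succ_of_adj hadj]
    refine le_trans ?_ (h1 hadj)
    refine le_trans ?_ (mul_le_mul_of_nonneg_left hs hα.le)
    have : 0 ≤ α * (α ^ backDeg H i h * β ^ (i : ℕ) * N) := by positivity
    calc α ^ (backDeg H i h + 1) * β ^ ((i : ℕ) + 1) * N
        = α * (α ^ backDeg H i h * β ^ (i : ℕ) * N) * β := by ring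
      _ ≤ α * (α ^ backDeg H i h * β ^ (i : ℕ) * N) * 1 := by gcongr
      _ = _ := by ring
  · rw [backDeg_succ_of_not_adj hadj]
    refine le_trans (le_of_eq ?_) ((mul_le_mul_of_nonneg_left hs hβ.le).trans (h2 hadj))
    ring

theorem card_sub_le_card_filter_forall_notMem {C : Finset V} {S : Finset (Fin k)}
    {Bad : Fin k → Finset V} {M : ℝ} (hM : 0 ≤ M) (hBad : ∀ h ∈ S, (#(Bad h) : ℝ) ≤ M) :
    (#C : ℝ) - k * M ≤ #{v ∈ C | ∀ h ∈ S, v ∉ Bad h} := by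
  have h1 : C ⊆ {v ∈ C | ∀ h ∈ S, v ∉ Bad h} ∪ S.biUnion Bad := by
    intro v hv
    by_cases hg : ∀ h ∈ S, v ∉ Bad h
    · exact mem_union_left _ (mem_filter.2 ⟨hv, hg⟩)
    · push Not at hg
      simp only [mem_union, mem_biUnion]
      exact Or.inr hg
  have h2 : #C ≤ #{v ∈ C | ∀ h ∈ S, v ∉ Bad h} + ∑ h ∈ S, #(Bad h) :=
    (card_le_card h1).trans ((card_union_le _ _).trans (by gcongr; exact card_biUnion_le))
  have h3 : (∑ h ∈ S, (#(Bad h) : ℝ)) ≤ k * M := by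
    refine (sum_le_sum hBad).trans ?_
    rw [sum_const, nsmul_eq_mul]
    have : #S ≤ k := (card_le_univ S).trans (by simp)
    gcongr
  have h4 : (#C : ℝ) ≤ #{v ∈ C | ∀ h ∈ S, v ∉ Bad h} + ∑ h ∈ S, (#(Bad h) : ℝ) := by
    exact_mod_cast h2
  linarith

/-- The lost 1 accounts for v itself, which non-adjacency in G does not exclude. -/
theorem relDeg_sub_one_le_card (r : V → V → Prop) (v : V) (B : Finset V) :
    relDeg r v B - 1 ≤ #{x ∈ B | r v x ∧ x ≠ v} := by
  have h1 : ({x ∈ B | r v x} : Finset V) ⊆ insert v {x ∈ B | r v x ∧ x ≠ v} := by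
    intro x
    simp only [mem_filter, mem_insert]
    tauto
  have h2 := (card_le_card h1).trans (card_insert_le _ _)
  have h3 : (#({x ∈ B | r v x} : Finset V) : ℝ) ≤ #{x ∈ B | r v x ∧ x ≠ v} + 1 := by
    exact_mod_cast h2
  unfold relDeg
  linarith

/-- Greedy embedding inside a set all of whose large subsets span many `R`-pairs. -/
theorem exists_compatible_of_dense (G : SimpleGraph V) (R : V → V → Prop) {δ M T : ℝ} (hk : 2 ≤ k)
    (hd : ∀ i : Fin k, #{j | j < i ∧ H.Adj j i} ≤ d)
    (hG : IsUniformRel (fun x y => ¬ G.Adj x y) (1 - 1 / k) δ M) (hM : 0 < M) (hMT : M ≤ T)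
    (hδ : δ + 1 / T ≤ 1 / (2 * k)) (hα : 0 < α) (hα1 : α ≤ 1) (U : Finset V)
    (hU : ∀ A B, A ⊆ U → B ⊆ U → T ≤ #A → T ≤ #B → α * #A * #B ≤ relSum R A B)
    (hT : 2 * k * T ≤ α ^ d * ((1 - 1 / k : ℝ) ^ 2) ^ k * #U) :
    ∃ f : Fin k → V, ∀ a b, a < b → Compatible H G R a b (f a) (f b) := by
  have hk0 : (2 : ℝ) ≤ k := by exact_mod_cast hk
  have hT0 : 0 < T := hM.trans_le hMT
  have hp : (1 : ℝ) / k ≤ 1 / 2 := by gcongr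
  have hp0 : (0 : ℝ) < 1 / k := by positivity
  set β : ℝ := (1 - 1 / k : ℝ) ^ 2 with hβdef
  have hβ : 0 < β := by
    have : (0 : ℝ) < 1 - 1 / k := by linarith
    positivity
  have hβ1 : β ≤ 1 := pow_le_one₀ (by linarith) (by linarith)
  -- The second factor 1 - 1/k in β pays for the uniformity error δ and for the 1/T lost by deleting
  -- v from a candidate set.
  have hβδ : β ≤ 1 - 1 / k - δ - 1 / T := by
    have : (1 : ℝ) / (2 * k) = 1 / k / 2 := by field_simp
    rw [hβdef]
    nlinarith
  refine exists_map_of_greedy H G R (fun i C => ∀ h : Fin k, i ≤ h → C h ⊆ U ∧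
    α ^ backDeg H i h * β ^ i * #U ≤ #(C h)) (fun _ => U) ?_ ?_
  · intro h _
    simp [backDeg_zero]
  intro i C hC
  have hsize : ∀ h : Fin k, i ≤ h → 2 * k * T ≤ #(C h) := fun h hh =>
    hT.trans (le_trans (by
      have := pow_mul_pow_le_backDeg hα hα1 hβ hβ1 hd (i := i) (h := h) hh
      gcongr) (hC h hh).2)
  have hsizeT : ∀ h : Fin k, i ≤ h → T ≤ #(C h) := fun h hh => by
    have := hsize h hh
    nlinarith
  -- The choices of v that shrink the candidates of h too much. At most T are bad for each h, while
  -- C i has at least 2kT elements, so a good choice remains.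
  let Bad : Fin k → Finset V := fun h => if H.Adj i h then {v ∈ C i | relDeg R v (C h) < α * #(C h)}
    else {v ∈ C i | relDeg (fun x y => ¬ G.Adj x y) v (C h) < (1 - 1 / k - δ) * #(C h)}
  have hBad : ∀ h ∈ ({h | i < h} : Finset (Fin k)), (#(Bad h) : ℝ) ≤ T := by
    intro h hh
    have hih : i < h := by simpa using hh
    simp only [Bad]
    split_ifs with hadj
    · by_contra! hcon
      set S := {v ∈ C i | relDeg R v (C h) < α * #(C h)} with hS
      have hne : S.Nonempty := by
        rw [← Finset.card_pos]; exact_mod_cast hT0.trans hcon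
      have h2 : relSum R S (C h) < ∑ _v ∈ S, α * #(C h) :=
        Finset.sum_lt_sum_of_nonempty hne fun v hv => (mem_filter.1 hv).2
      rw [sum_const, nsmul_eq_mul] at h2
      have h3 := hU S (C h) ((filter_subset _ _).trans (hC i le_rfl).1) (hC h hih.le).1 hcon.le
        (hsizeT h hih.le)
      linarith
    · exact (hG.card_low_lt hM (hMT.trans (hsizeT h hih.le))).le.trans hMT
  have hgood := card_sub_le_card_filter_forall_notMem (C := C i) hT0.le hBad
  have hpos : (0 : ℝ) < #{v ∈ C i | ∀ h ∈ ({h | i < h} : Finset (Fin k)), v ∉ Bad h} := by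
    have := hsize i le_rfl
    nlinarith
  obtain ⟨v, hv⟩ := Finset.card_pos.1 (by exact_mod_cast hpos :
    0 < #{v ∈ C i | ∀ h ∈ ({h | i < h} : Finset (Fin k)), v ∉ Bad h})
  rw [mem_filter] at hv
  refine ⟨v, hv.1, fun h => if H.Adj i h then {x ∈ C h | R v x}
    else {x ∈ C h | ¬ G.Adj v x ∧ x ≠ v}, ?_, ?_⟩
  · intro h hh
    have hih : i < h := hh
    have hvb := hv.2 h (by simpa using hih)
    refine ⟨?_, backDeg_bound_succ hα hβ hβ1 (Nat.cast_nonneg _) (hC h hih.le).2 ?_ ?_⟩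
    · dsimp only
      split_ifs
      · exact (filter_subset _ _).trans (hC h hih.le).1
      · exact (filter_subset _ _).trans (hC h hih.le).1
    · intro hadj
      simp only [Bad, if_pos hadj, mem_filter, hv.1, true_and, not_lt] at hvb
      simp only [if_pos hadj]
      exact hvb
    · intro hadj
      simp only [Bad, if_neg hadj, mem_filter, hv.1, true_and, not_lt] at hvb
      simp only [if_neg hadj]
      refine le_trans ?_
        ((relDeg_sub_one_le_card (fun x y => ¬ G.Adj x y) v (C h)).trans_eq (by congr))
      have h1 : 1 ≤ 1 / T * #(C h) := by
        rw [div_mul_eq_mul_div, le_div_iff₀ hT0]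
        linarith [hsizeT h hih.le]
      have := mul_le_mul_of_nonneg_right hβδ (Nat.cast_nonneg (α := ℝ) #(C h))
      linarith
  · intro h hih
    by_cases hadj : H.Adj i h
    · simp only [if_pos hadj]
      exact ⟨filter_subset _ _, fun x hx => ⟨fun _ => (mem_filter.1 hx).2, fun h => absurd hadj h⟩⟩
    · simp only [if_neg hadj]
      exact ⟨filter_subset _ _, fun x hx => ⟨fun h => absurd h hadj, fun _ => (mem_filter.1 hx).2⟩⟩

end Candidates

/-! ### Families of pairwise sparse sets. -/

section SparseFamily

open Finset
open scoped Classical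

variable {V : Type*}

/-- Markov's inequality for degrees into B. -/
theorem mul_card_filter_lt_relDeg_le {R : V → V → Prop} {A B : Finset V} {c K : ℝ} (hc : 0 < c)
    (hB : 0 < #B) (h : relSum R A B ≤ c * #A * #B) :
    K * #{a ∈ A | K * c * #B < relDeg R a B} ≤ #A := by
  set S := {a ∈ A | K * c * #B < relDeg R a B} with hS
  have hB' : (0 : ℝ) < #B := by exact_mod_cast hB
  have h1 : ∑ _a ∈ S, K * c * #B ≤ relSum R A B :=
    (sum_le_sum fun a ha => (mem_filter.1 ha).2.le).trans
      (sum_le_sum_of_subset_of_nonneg (filter_subset _ _) fun v _ _ => relDeg_nonneg v)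
  rw [sum_const, nsmul_eq_mul] at h1
  have h2 : (K * #S) * (c * #B) ≤ #A * (c * #B) := by linarith
  exact le_of_mul_le_mul_right h2 (by positivity)

theorem relSum_le_of_forall_relDeg_le {R : V → V → Prop} {A B : Finset V} {c : ℝ}
    (h : ∀ a ∈ A, relDeg R a B ≤ c * #B) : relSum R A B ≤ c * #A * #B := by
  refine (sum_le_sum h).trans ?_
  rw [sum_const, nsmul_eq_mul]
  exact le_of_eq (by ring)

/-- If every large set contains a pair of large sets with few `R`-pairs, then there are many
large sets with few `R`-pairs between any two of them. -/
theorem exists_sparse_family {R : V → V → Prop} (hR : ∀ x y, R x y ↔ R y x) {c ρ N : ℝ}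
    (hc : 0 < c) (hρ : 0 < ρ) (hρ1 : ρ ≤ 1) (hN : 0 < N)
    (h : ∀ U : Finset V, N ≤ #U → ∃ A B, A ⊆ U ∧ B ⊆ U ∧ ρ * #U ≤ #A ∧ ρ * #U ≤ #B ∧
      relSum R A B ≤ c * #A * #B) (t : ℕ) :
    ∀ U : Finset V, N * (2 / ρ) ^ t ≤ #U → ∃ F : ℕ → Finset V,
      (∀ i < 2 ^ t, F i ⊆ U ∧ N ≤ #(F i)) ∧
      ∀ i < 2 ^ t, ∀ j < 2 ^ t, i ≠ j →
        relSum R (F i) (F j) ≤ (4 * 2 ^ t * c) * #(F i) * #(F j) := by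
  induction t with
  | zero =>
    intro U hU
    refine ⟨fun _ => U, fun i _ => ⟨subset_rfl, by simpa using hU⟩, ?_⟩
    intro i hi j hj hij
    simp at hi hj
    omega
  | succ t ih =>
    intro U hU
    have h2ρ : 1 ≤ 2 / ρ := by rw [le_div_iff₀ hρ]; linarith
    have hNU : N ≤ #U := le_trans (le_mul_of_one_le_right hN.le (one_le_pow₀ h2ρ)) hU
    obtain ⟨A, B, hAU, hBU, hA, hB, hAB⟩ := h U hNU
    have hρU : 0 < ρ * #U := mul_pos hρ (hN.trans_le hNU)
    have hB0 : 0 < #B := by exact_mod_cast hρU.trans_le hB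
    -- Passing to A or B costs a factor ρ, and discarding vertices of large degree costs a further
    -- 2.
    have hstep : N * (2 / ρ) ^ t ≤ ρ * #U / 2 := by
      rw [pow_succ] at hU
      rw [le_div_iff₀ two_pos]
      have := mul_le_mul_of_nonneg_left hU hρ.le
      have h3 : ρ * (N * ((2 / ρ) ^ t * (2 / ρ))) = N * (2 / ρ) ^ t * 2 := by
        field_simp
      linarith
    -- Bounding individual degrees into B makes sparseness to B pass to every subset of A', in
    -- particular to the sets of the first recursive family.
    set A' := {a ∈ A | ¬ 2 * c * #B < relDeg R a B} with hA'
    have hA'card : (#A : ℝ) / 2 ≤ #A' := by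
      have h1 := mul_card_filter_lt_relDeg_le (K := 2) hc hB0 hAB
      have h2 := card_filter_add_card_filter_not (s := A) (fun a => 2 * c * #B < relDeg R a B)
      have h3 : (#{a ∈ A | 2 * c * #B < relDeg R a B} : ℝ) + #A' = #A := by exact_mod_cast h2
      linarith
    obtain ⟨F₁, hF₁, hF₁'⟩ := ih A' (by linarith)
    have hF₁0 : ∀ i < 2 ^ t, 0 < #(F₁ i) := fun i hi => by
      exact_mod_cast hN.trans_le (hF₁ i hi).2
    have hdeg : ∀ i < 2 ^ t, relSum R B (F₁ i) ≤ (2 * c) * #B * #(F₁ i) := by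
      intro i hi
      rw [relSum_comm hR]
      have := relSum_le_of_forall_relDeg_le (R := R) (A := F₁ i) (B := B) (c := 2 * c) fun a ha =>
        not_lt.1 (mem_filter.1 ((hF₁ i hi).1 ha)).2
      linarith
    -- Only now, with the F₁ i known, is B trimmed. The Markov factor 2 * 2^t makes the union over
    -- all 2^t sets discard at most half of B, and 2 * 2^t * 2c is the density in the conclusion.
    set B' := {b ∈ B | ∀ i < 2 ^ t, ¬ (2 * 2 ^ t) * (2 * c) * #(F₁ i) < relDeg R b (F₁ i)} with hB'
    have hB'card : (#B : ℝ) / 2 ≤ #B' := by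
      have h1 : B ⊆ B' ∪ (range (2 ^ t)).biUnion fun i =>
          {b ∈ B | (2 * 2 ^ t) * (2 * c) * #(F₁ i) < relDeg R b (F₁ i)} := by
        intro b hb
        by_cases hg : ∀ i < 2 ^ t, ¬ (2 * 2 ^ t) * (2 * c) * #(F₁ i) < relDeg R b (F₁ i)
        · exact mem_union_left _ (mem_filter.2 ⟨hb, hg⟩)
        · push Not at hg
          obtain ⟨i, hi, hlt⟩ := hg
          exact mem_union_right _ (mem_biUnion.2 ⟨i, mem_range.2 hi, mem_filter.2 ⟨hb, hlt⟩⟩)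
      have h2 : #B ≤ #B' + ∑ i ∈ range (2 ^ t),
          #{b ∈ B | (2 * 2 ^ t) * (2 * c) * #(F₁ i) < relDeg R b (F₁ i)} :=
        (card_le_card h1).trans ((card_union_le _ _).trans (by gcongr; exact card_biUnion_le))
      have h3 : (#B : ℝ) ≤ #B' + ∑ i ∈ range (2 ^ t),
          (#{b ∈ B | (2 * 2 ^ t) * (2 * c) * #(F₁ i) < relDeg R b (F₁ i)} : ℝ) := by
        exact_mod_cast h2
      have h4 : ∑ i ∈ range (2 ^ t),
          (#{b ∈ B | (2 * 2 ^ t) * (2 * c) * #(F₁ i) < relDeg R b (F₁ i)} : ℝ) ≤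
          ∑ i ∈ range (2 ^ t), (#B : ℝ) / (2 * 2 ^ t) := by
        refine sum_le_sum fun i hi => ?_
        rw [le_div_iff₀ (by positivity), mul_comm]
        exact mul_card_filter_lt_relDeg_le (by positivity) (hF₁0 i (mem_range.1 hi))
          (hdeg i (mem_range.1 hi))
      rw [sum_const, nsmul_eq_mul, card_range] at h4
      have h5 : ((2 ^ t : ℕ) : ℝ) * ((#B : ℝ) / (2 * 2 ^ t)) = #B / 2 := by
        push_cast; field_simp
      linarith
    obtain ⟨F₂, hF₂, hF₂'⟩ := ih B' (by linarith)
    have hcross : ∀ i < 2 ^ t, ∀ j < 2 ^ t,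
        relSum R (F₂ j) (F₁ i) ≤ (4 * 2 ^ t * c) * #(F₂ j) * #(F₁ i) := by
      intro i hi j hj
      refine relSum_le_of_forall_relDeg_le fun a ha => ?_
      have := (mem_filter.1 ((hF₂ j hj).1 ha)).2 i hi
      linarith [not_lt.1 this]
    have hmono : ∀ X Y : Finset V, relSum R X Y ≤ (4 * 2 ^ t * c) * #X * #Y →
        relSum R X Y ≤ (4 * 2 ^ (t + 1) * c) * #X * #Y := by
      intro X Y hXY
      refine hXY.trans ?_
      have : (2 : ℝ) ^ t ≤ 2 ^ (t + 1) := pow_le_pow_right₀ (by norm_num) (by omega)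
      gcongr
    have hpow : 2 ^ (t + 1) = 2 ^ t + 2 ^ t := by ring
    refine ⟨fun i => if i < 2 ^ t then F₁ i else F₂ (i - 2 ^ t), ?_, ?_⟩
    · intro i hi
      by_cases h1 : i < 2 ^ t
      · simp only [if_pos h1]
        exact ⟨((hF₁ i h1).1.trans (filter_subset _ _)).trans hAU, (hF₁ i h1).2⟩
      · simp only [if_neg h1]
        have h2 : i - 2 ^ t < 2 ^ t := by omega
        exact ⟨((hF₂ _ h2).1.trans (filter_subset _ _)).trans hBU, (hF₂ _ h2).2⟩
    · intro i hi j hj hij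
      apply hmono
      by_cases h1 : i < 2 ^ t <;> by_cases h2 : j < 2 ^ t
      · simp only [if_pos h1, if_pos h2]
        exact hF₁' i h1 j h2 hij
      · simp only [if_pos h1, if_neg h2]
        rw [relSum_comm hR]
        have := hcross i h1 (j - 2 ^ t) (by omega)
        linarith
      · simp only [if_neg h1, if_pos h2]
        exact hcross j h2 (i - 2 ^ t) (by omega)
      · simp only [if_neg h1, if_neg h2]
        exact hF₂' _ (by omega) _ (by omega) (by omega)

end SparseFamily

/-! ### Averaging the potential, and the numerical estimates for its growth. -/

section Potential

open Finset
open scoped Classical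

variable {V : Type*} {k : ℕ}

/-- The density of `R` between `A` and `B`. -/
noncomputable def relDens (R : V → V → Prop) (A B : Finset V) : ℝ :=
  relSum R A B / (#A * #B)

theorem relDens_nonneg {R : V → V → Prop} {A B : Finset V} : 0 ≤ relDens R A B :=
  div_nonneg relSum_nonneg (by positivity)

/-- `sum_relSum_filter_le` divided by the expected sizes: as the weights are at least x, the error
x^10 becomes a relative error x^9, and M ≤ x^22 T leaves an additive error 2 x^20. -/
theorem sum_relSum_filter_div_le {R r₁ r₂ : V → V → Prop} {A B D : Finset V} {x M T w₁ w₂ : ℝ}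
    (hx : 0 < x) (hx1 : x ≤ 1 / 2) (hM : 0 < M) (hMT : M ≤ x ^ 22 * T)
    (h₁ : IsUniformRel r₁ w₁ (x ^ 10) M) (h₂ : IsUniformRel r₂ w₂ (x ^ 10) M)
    (hs₁ : ∀ x y, r₁ x y ↔ r₁ y x) (hs₂ : ∀ x y, r₂ x y ↔ r₂ y x)
    (hw₁ : x ≤ w₁) (hw₂ : x ≤ w₂) (hA : T ≤ #A) (hB : T ≤ #B) (hD : T ≤ #D) :
    ∑ v ∈ D, relSum R {y ∈ A | r₁ v y} {y ∈ B | r₂ v y} / (w₁ * w₂ * (#A * #B)) ≤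
      #D * ((1 + x ^ 9) ^ 2 * relDens R A B + 2 * x ^ 20) := by
  have hT : 0 < T := by
    by_contra! hcon
    have : x ^ 22 * T ≤ 0 := mul_nonpos_of_nonneg_of_nonpos (by positivity) hcon
    linarith
  have hx22 : x ^ 22 ≤ x ^ 2 := pow_le_pow_of_le_one hx.le (by linarith) (by norm_num)
  have hx2 : x ^ 2 ≤ 1 := pow_le_one₀ hx.le (by linarith)
  have hMD : M ≤ x ^ 2 * #D := hMT.trans (by gcongr)
  have hD0 : (0 : ℝ) < #D := hT.trans_le hD
  have hA0 : (0 : ℝ) < #A := hT.trans_le hA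
  have hB0 : (0 : ℝ) < #B := hT.trans_le hB
  have hw₁0 : 0 < w₁ := hx.trans_le hw₁
  have hw₂0 : 0 < w₂ := hx.trans_le hw₂
  have hx10 : 0 < x ^ 10 := by positivity
  have key := sum_relSum_filter_le (A := A) (B := B) (C := D) R h₁ h₂ hs₁ hs₂ hM (by positivity)
    (hMD.trans (by nlinarith)) (hMD.trans (by
      gcongr
      rw [sq]
      exact mul_le_mul (by linarith) (by linarith) hx.le (by linarith)))
  rw [← Finset.sum_div, div_le_iff₀ (by positivity)]
  refine key.trans ?_
  have e1 : w₁ + x ^ 10 ≤ w₁ * (1 + x ^ 9) := by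
    have : x ^ 10 = x * x ^ 9 := by ring
    have h9 : 0 < x ^ 9 := by positivity
    nlinarith
  have e2 : w₂ + x ^ 10 ≤ w₂ * (1 + x ^ 9) := by
    have : x ^ 10 = x * x ^ 9 := by ring
    have h9 : 0 < x ^ 9 := by positivity
    nlinarith
  have e3 : (w₁ + x ^ 10) * (w₂ + x ^ 10) ≤ w₁ * w₂ * (1 + x ^ 9) ^ 2 := by
    calc _ ≤ (w₁ * (1 + x ^ 9)) * (w₂ * (1 + x ^ 9)) :=
          mul_le_mul e1 e2 (by positivity) (by positivity)
      _ = _ := by ring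
  have e4 : relSum R A B = relDens R A B * (#A * #B) := by
    rw [relDens, div_mul_cancel₀ _ (by positivity)]
  have e5 : M * (#A + #B) ≤ 2 * x ^ 20 * (w₁ * w₂) * (#A * #B) := by
    have f1 : x ^ 2 ≤ w₁ * w₂ := by rw [sq]; exact mul_le_mul hw₁ hw₂ hx.le hw₁0.le
    have f2 : M * #A ≤ x ^ 22 * (#A * #B) := by
      calc M * #A ≤ (x ^ 22 * T) * #A := by gcongr
        _ ≤ (x ^ 22 * #B) * #A := by gcongr
        _ = _ := by ring
    have f3 : M * #B ≤ x ^ 22 * (#A * #B) := by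
      calc M * #B ≤ (x ^ 22 * T) * #B := by gcongr
        _ ≤ (x ^ 22 * #A) * #B := by gcongr
        _ = _ := by ring
    calc M * (#A + #B) ≤ 2 * x ^ 20 * x ^ 2 * (#A * #B) := by
          have : 2 * x ^ 20 * x ^ 2 * (#A * #B : ℝ) = 2 * (x ^ 22 * (#A * #B)) := by ring
          linarith
      _ ≤ _ := by gcongr
  have e6 : 0 ≤ relSum R A B := relSum_nonneg
  calc _ ≤ w₁ * w₂ * (1 + x ^ 9) ^ 2 * #D * relSum R A B +
        (2 * x ^ 20 * (w₁ * w₂) * (#A * #B)) * #D := by gcongr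
    _ = _ := by rw [e4]; ring

/-- The averaging step: some vertex of `D` is typical for all candidate sets and does not increase
the total density. -/
theorem exists_vertex_potential_le {R : V → V → Prop} {r : Fin k → V → V → Prop} {W : Fin k → ℝ}
    {C : Fin k → Finset V} {D : Finset V} {x M T : ℝ} (hk : 2 ≤ k) (hxk : x = 1 / k)
    (hM : 0 < M) (hMT : M ≤ x ^ 22 * T) (S J : Finset (Fin k)) (P : Finset (Fin k × Fin k))
    (hJ : J ⊆ S) (hP : ∀ q ∈ P, q.1 ∈ S ∧ q.2 ∈ S)
    (hr : ∀ h, IsUniformRel (r h) (W h) (x ^ 10) M) (hs : ∀ h y z, r h y z ↔ r h z y)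
    (hW : ∀ h, x ≤ W h) (hC : ∀ h ∈ S, T ≤ #(C h)) (hD : T ≤ #D) :
    ∃ v ∈ D, (∀ h ∈ S, (W h - x ^ 10) * #(C h) ≤ relDeg (r h) v (C h)) ∧
      (1 - x ^ 21) * ((∑ q ∈ P, relSum R {y ∈ C q.1 | r q.1 v y} {y ∈ C q.2 | r q.2 v y} /
          (W q.1 * W q.2 * (#(C q.1) * #(C q.2)))) + ∑ h ∈ J, relDeg R v (C h) / #(C h)) ≤
        (1 + x ^ 9) ^ 2 * ((∑ q ∈ P, relDens R (C q.1) (C q.2)) + ∑ h ∈ J, relDens R D (C h)) +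
          2 * x ^ 18 := by
  have hk0 : (2 : ℝ) ≤ k := by exact_mod_cast hk
  have hx : 0 < x := by rw [hxk]; positivity
  have hx1 : x ≤ 1 / 2 := by rw [hxk]; gcongr
  have hkx : (k : ℝ) * x = 1 := by rw [hxk]; field_simp
  have hx22 : x ^ 22 ≤ 1 := pow_le_one₀ hx.le (by linarith)
  have hx21 : x ^ 21 ≤ x := by
    simpa using pow_le_pow_of_le_one hx.le (by linarith) (by norm_num : 1 ≤ 21)
  have hT : 0 < T := by
    by_contra! hcon
    have : x ^ 22 * T ≤ 0 := mul_nonpos_of_nonneg_of_nonpos (by positivity) hcon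
    linarith
  have hMT' : M ≤ T := hMT.trans (by nlinarith)
  have hD0 : (0 : ℝ) < #D := hT.trans_le hD
  set X : V → ℝ := fun v => ∑ q ∈ P, relSum R {y ∈ C q.1 | r q.1 v y} {y ∈ C q.2 | r q.2 v y} /
          (W q.1 * W q.2 * (#(C q.1) * #(C q.2))) with hX
  set Y : V → ℝ := fun v => ∑ h ∈ J, relDeg R v (C h) / #(C h) with hY
  set E := (1 + x ^ 9) ^ 2 * ((∑ q ∈ P, relDens R (C q.1) (C q.2)) + ∑ h ∈ J, relDens R D (C h)) +
          2 * x ^ 18 with hE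
  have hW0 : ∀ h, 0 < W h := fun h => hx.trans_le (hW h)
  have hX0 : ∀ v, 0 ≤ X v := fun v => sum_nonneg fun q _ =>
    div_nonneg relSum_nonneg (mul_nonneg (mul_pos (hW0 _) (hW0 _)).le (by positivity))
  have hY0 : ∀ v, 0 ≤ Y v := fun v => sum_nonneg fun q _ =>
    div_nonneg (relDeg_nonneg _) (by positivity)
  have hXsum : ∑ v ∈ D, X v ≤
      #D * ((1 + x ^ 9) ^ 2 * (∑ q ∈ P, relDens R (C q.1) (C q.2)) + 2 * x ^ 18) := by
    have hq : ∀ q ∈ P, ∑ v ∈ D, relSum R {y ∈ C q.1 | r q.1 v y} {y ∈ C q.2 | r q.2 v y} /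
        (W q.1 * W q.2 * (#(C q.1) * #(C q.2))) ≤
        #D * ((1 + x ^ 9) ^ 2 * relDens R (C q.1) (C q.2) + 2 * x ^ 20) := fun q hq =>
      sum_relSum_filter_div_le hx hx1 hM hMT (hr q.1) (hr q.2)
        (hs q.1) (hs q.2) (hW q.1) (hW q.2) (hC _ (hP q hq).1) (hC _ (hP q hq).2) hD
    rw [hX, Finset.sum_comm]
    refine (sum_le_sum hq).trans ?_
    rw [← mul_sum, sum_add_distrib, ← mul_sum, sum_const, nsmul_eq_mul]
    -- There are at most k² = x^(-2) pairs, which accounts for x^18.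
    have : (#P : ℝ) * (2 * x ^ 20) ≤ 2 * x ^ 18 := by
      have h1 : #P ≤ k * k := (card_le_univ P).trans (by simp)
      have h2 : (#P : ℝ) ≤ k * k := by exact_mod_cast h1
      calc (#P : ℝ) * (2 * x ^ 20) ≤ (k * k) * (2 * x ^ 20) := by gcongr
        _ = 2 * x ^ 18 * (k * x) ^ 2 := by ring
        _ = _ := by rw [hkx]; ring
    gcongr
  have hYsum : ∑ v ∈ D, Y v = #D * ∑ h ∈ J, relDens R D (C h) := by
    rw [hY, Finset.sum_comm, mul_sum]
    refine sum_congr rfl fun h hh => ?_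
    have hC0 : (0 : ℝ) < #(C h) := hT.trans_le (hC h (hJ hh))
    rw [← sum_div, relDens]
    change relSum R D (C h) / _ = _
    field_simp
  have hJ0 : 0 ≤ ∑ h ∈ J, relDens R D (C h) := sum_nonneg fun _ _ => relDens_nonneg
  have hXY : ∑ v ∈ D, (X v + Y v) ≤ #D * E := by
    rw [sum_add_distrib, hYsum, hE]
    refine (add_le_add_left hXsum _).trans ?_
    rw [← mul_add]
    refine mul_le_mul_of_nonneg_left ?_ hD0.le
    have h9 : 1 ≤ (1 + x ^ 9) ^ 2 := one_le_pow₀ (by have : 0 < x ^ 9 := by positivity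
                                                     linarith)
    nlinarith
  let Bad : Fin k → Finset V := fun h => {v ∈ D | relDeg (r h) v (C h) < (W h - x ^ 10) * #(C h)}
  have hBad : ∀ h ∈ S, (#(Bad h) : ℝ) ≤ M := fun h hh =>
    ((hr h).card_low_lt hM (hMT'.trans (hC h hh))).le
  have hgood := card_sub_le_card_filter_forall_notMem (C := D) hM.le hBad
  set Good := {v ∈ D | ∀ h ∈ S, v ∉ Bad h} with hGood
  have hGood1 : (1 - x ^ 21) * #D ≤ #Good := by
    have : (k : ℝ) * M ≤ x ^ 21 * #D := by
      calc (k : ℝ) * M ≤ k * (x ^ 22 * #D) := by gcongr; exact hMT.trans (by gcongr)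
        _ = (k * x) * (x ^ 21 * #D) := by ring
        _ = _ := by rw [hkx, one_mul]
    linarith
  have hGood0 : Good.Nonempty := by
    rw [← Finset.card_pos]
    have : (0 : ℝ) < #Good := lt_of_lt_of_le (mul_pos (by linarith) hD0) hGood1
    exact_mod_cast this
  -- X + Y is non-negative, so discarding the atypical vertices does not increase its sum; the
  -- average over `Good` rises by at most 1 / (1 - x^21).
  obtain ⟨v, hv, hvle⟩ : ∃ v ∈ Good, (1 - x ^ 21) * (X v + Y v) ≤ E := by
    by_contra! hcon
    have h1 : ∑ _v ∈ Good, E < ∑ v ∈ Good, (1 - x ^ 21) * (X v + Y v) :=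
      sum_lt_sum_of_nonempty hGood0 hcon
    rw [sum_const, nsmul_eq_mul, ← mul_sum] at h1
    have h2 : ∑ v ∈ Good, (X v + Y v) ≤ ∑ v ∈ D, (X v + Y v) :=
      sum_le_sum_of_subset_of_nonneg (filter_subset _ _) fun v _ _ => add_nonneg (hX0 v) (hY0 v)
    have h3 : 0 ≤ E := by
      have : 0 ≤ ∑ q ∈ P, relDens R (C q.1) (C q.2) := sum_nonneg fun _ _ => relDens_nonneg
      positivity
    have h4 := mul_le_mul_of_nonneg_left (h2.trans hXY) (by linarith : 0 ≤ 1 - x ^ 21)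
    have h5 := mul_le_mul_of_nonneg_right hGood1 h3
    linarith
  have hv' := mem_filter.1 hv
  refine ⟨v, hv'.1, fun h hh => ?_, hvle⟩
  have := hv'.2 h hh
  simp only [Bad, mem_filter, hv'.1, true_and, not_lt] at this
  exact this

theorem one_add_pow_nine_sq_le {x : ℝ} (hx : 0 < x) (hx1 : x ≤ 1 / 2) :
    (1 + x ^ 9) ^ 2 + 2 * x ^ 6 ≤ 1 + x ^ 4 := by
  have h6 : x ^ 6 = x ^ 4 * x ^ 2 := by ring
  have h9 : x ^ 9 ≤ x ^ 4 * (1 / 2) ^ 5 := by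
    rw [show x ^ 9 = x ^ 4 * x ^ 5 by ring]; gcongr
  have h2 : x ^ 2 ≤ (1 / 2) ^ 2 := by gcongr
  have h92 : x ^ 9 ≤ 1 := pow_le_one₀ hx.le (by linarith)
  have h90 : 0 < x ^ 9 := by positivity
  have h4 : 0 < x ^ 4 := by positivity
  nlinarith

theorem one_add_pow_four_le {x : ℝ} (hx : 0 < x) (hx1 : x ≤ 1 / 2) :
    1 + x ^ 4 ≤ (1 + x) * ((1 - x ^ 21) * (1 - x ^ 5) ^ 2) := by
  have h4 : x ^ 4 ≤ x * (1 / 2) ^ 3 := by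
    rw [show x ^ 4 = x * x ^ 3 by ring]; gcongr
  have h5 : x ^ 5 ≤ x * (1 / 2) ^ 4 := by
    rw [show x ^ 5 = x * x ^ 4 by ring]; gcongr
  have h21 : x ^ 21 ≤ x ^ 5 := pow_le_pow_of_le_one hx.le (by linarith) (by norm_num)
  have h50 : 0 < x ^ 5 := by positivity
  set y := x ^ 5
  have h1 : (1 - y) ^ 3 ≤ (1 - x ^ 21) * (1 - y) ^ 2 := by
    rw [show (1 - y) ^ 3 = (1 - y) * (1 - y) ^ 2 by ring]
    gcongr
  have h2 : 1 - 3 * y ≤ (1 - y) ^ 3 := by nlinarith [mul_pos h50 h50]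
  have h3 : (1 + x) * (1 - 3 * y) ≤ (1 + x) * ((1 - x ^ 21) * (1 - y) ^ 2) :=
    mul_le_mul_of_nonneg_left (h2.trans h1) (by linarith)
  nlinarith

/-- Total growth of the potential: k factors 1 + 1/k multiply to at most e. -/
theorem one_add_inv_pow_le_four {k i : ℕ} (hk : 0 < k) (hi : i ≤ k) :
    (1 + 1 / (k : ℝ)) ^ i ≤ 4 := by
  have hk' : (0 : ℝ) < k := by exact_mod_cast hk
  have h1 : (1 + 1 / (k : ℝ)) ≤ Real.exp (1 / k) := by
    linarith [Real.add_one_le_exp (1 / (k : ℝ))]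
  calc (1 + 1 / (k : ℝ)) ^ i ≤ (1 + 1 / (k : ℝ)) ^ k :=
        pow_le_pow_right₀ (by have : 0 < 1 / (k : ℝ) := by positivity
                              linarith) hi
    _ ≤ (Real.exp (1 / k)) ^ k := by gcongr
    _ = Real.exp 1 := by rw [← Real.exp_nat_mul]; congr 1; field_simp
    _ ≤ 4 := by linarith [Real.exp_one_lt_d9]

end Potential

/-! ### Embedding in the sparse case. -/

section Sparse

open Finset
open scoped Classical

variable {V : Type*} {k : ℕ} {H : SimpleGraph (Fin k)} {d : ℕ}

/-- F bounds the old potential. As F ≥ x^12, the additive error 2 x^18 is at most 2 x^6 F and is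
absorbed. The bound on Y limits the candidates lost to `R`; the factor (1 - x^5)^2 in the bound on X
leaves room for the actual candidate sets being smaller than expected. -/
theorem potential_step {x F X Y D : ℝ} (hx : 0 < x) (hx1 : x ≤ 1 / 2) (hX : 0 ≤ X) (hY : 0 ≤ Y)
    (hF1 : x ^ 12 ≤ F) (hF4 : F ≤ 4 * x ^ 12) (hD : D ≤ F)
    (h : (1 - x ^ 21) * (X + Y) ≤ (1 + x ^ 9) ^ 2 * D + 2 * x ^ 18) :
    Y ≤ 16 * x ^ 12 ∧ X ≤ (1 + x) * F * (1 - x ^ 5) ^ 2 := by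
  have hF0 : 0 < F := lt_of_lt_of_le (by positivity) hF1
  have hx21 : x ^ 21 ≤ x ^ 1 := pow_le_pow_of_le_one hx.le (by linarith) (by norm_num)
  have hx4 : x ^ 4 ≤ 1 := pow_le_one₀ hx.le (by linarith)
  have hXY : (1 - x ^ 21) * (X + Y) ≤ F * (1 + x ^ 4) := by
    have h1 : (1 + x ^ 9) ^ 2 * D ≤ (1 + x ^ 9) ^ 2 * F :=
      mul_le_mul_of_nonneg_left hD (by positivity)
    have h2 : 2 * x ^ 18 ≤ F * (2 * x ^ 6) := by
      have : 2 * x ^ 18 = x ^ 12 * (2 * x ^ 6) := by ring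
      rw [this]; gcongr
    have h3 := mul_le_mul_of_nonneg_left (one_add_pow_nine_sq_le hx hx1) hF0.le
    linarith
  constructor
  · have h1 : F * (1 + x ^ 4) ≤ 4 * x ^ 12 * 2 :=
      mul_le_mul hF4 (by linarith) (by positivity) (by positivity)
    have h2 : 1 / 2 * (X + Y) ≤ (1 - x ^ 21) * (X + Y) :=
      mul_le_mul_of_nonneg_right (by linarith) (by positivity)
    linarith
  · have h1 := mul_le_mul_of_nonneg_left (one_add_pow_four_le hx hx1) hF0.le
    have h3 : (1 - x ^ 21) * X ≤ (1 - x ^ 21) * (X + Y) :=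
      mul_le_mul_of_nonneg_left (by linarith) (by linarith)
    have h2 : (1 - x ^ 21) * X ≤ (1 - x ^ 21) * ((1 + x) * F * (1 - x ^ 5) ^ 2) := by
      linarith
    exact le_of_mul_le_mul_left h2 (by linarith)

theorem sub_le_card_filter_and_not {r R : V → V → Prop} (v : V) (B : Finset V) :
    relDeg r v B - relDeg R v B ≤ #{x ∈ B | r v x ∧ ¬ R v x} := by
  have h1 : ({x ∈ B | r v x} : Finset V) ⊆ {x ∈ B | r v x ∧ ¬ R v x} ∪ {x ∈ B | R v x} := by
    intro x
    simp only [mem_filter, mem_union]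
    tauto
  have h2 := (card_le_card h1).trans (card_union_le _ _)
  have h3 : (#({x ∈ B | r v x} : Finset V) : ℝ) ≤
      #{x ∈ B | r v x ∧ ¬ R v x} + #({x ∈ B | R v x} : Finset V) := by
    exact_mod_cast h2
  unfold relDeg
  linarith

/-- The relation of `G` (adjacency or non-adjacency) prescribed by the pair `i`, `h` of `H`. -/
def pairRel (H : SimpleGraph (Fin k)) (G : SimpleGraph V) (i h : Fin k) (y z : V) : Prop :=
  G.Adj y z ↔ H.Adj i h

/-- The expected density of `pairRel H G i h` if `G` has density `x`. -/
noncomputable def pairWeight (H : SimpleGraph (Fin k)) (x : ℝ) (i h : Fin k) : ℝ :=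
  if H.Adj i h then x else 1 - x

/-- The candidates for `h` left when `v` becomes the image of `i`, if edges must avoid `R`. -/
noncomputable def nextCand (H : SimpleGraph (Fin k)) (G : SimpleGraph V) (R : V → V → Prop)
    (C : Fin k → Finset V) (i : Fin k) (v : V) (h : Fin k) : Finset V :=
  {y ∈ C h | Compatible H G (fun y z => G.Adj y z ∧ ¬ R y z) i h v y}

variable {G : SimpleGraph V} {R : V → V → Prop} {C : Fin k → Finset V} {x : ℝ} {i h : Fin k}

theorem mem_nextCand {v y : V} : y ∈ nextCand H G R C i v h ↔
    y ∈ C h ∧ Compatible H G (fun y z => G.Adj y z ∧ ¬ R y z) i h v y := by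
  rw [nextCand, mem_filter]

theorem pairRel_of_adj (hadj : H.Adj i h) : pairRel H G i h = G.Adj := by
  ext y z; simp [pairRel, hadj]

theorem pairRel_of_not_adj (hadj : ¬ H.Adj i h) : pairRel H G i h = fun y z => ¬ G.Adj y z := by
  ext y z; simp [pairRel, hadj]

theorem isUniformRel_pairRel {δ M : ℝ} (hG : IsUniformRel G.Adj x δ M) :
    IsUniformRel (pairRel H G i h) (pairWeight H x i h) δ M := by
  by_cases hadj : H.Adj i h
  · rw [pairRel_of_adj hadj, pairWeight, if_pos hadj]; exact hG
  · rw [pairRel_of_not_adj hadj, pairWeight, if_neg hadj]; exact hG.not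

theorem pairRel_comm (y z : V) : pairRel H G i h y z ↔ pairRel H G i h z y := by
  simp only [pairRel, G.adj_comm]

theorem le_pairWeight (hx1 : x ≤ 1 / 2) : x ≤ pairWeight H x i h := by
  unfold pairWeight
  split_ifs <;> linarith

theorem nextCand_subset (v : V) : nextCand H G R C i v h ⊆ {y ∈ C h | pairRel H G i h v y} := by
  intro y hy
  rw [mem_nextCand] at hy
  refine mem_filter.2 ⟨hy.1, fun h1 => ?_, fun h1 => (hy.2.1 h1).1⟩
  by_contra h2
  exact (hy.2.2 h2).1 h1

theorem pairWeight_sub_mul_le_card_nextCand {v : V} (hx : 0 < x) (hx1 : x ≤ 1 / 2)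
    (hv : (pairWeight H x i h - x ^ 10) * #(C h) ≤ relDeg (pairRel H G i h) v (C h))
    (hR : H.Adj i h → relDeg R v (C h) ≤ 16 * x ^ 12 * #(C h)) (hC : 1 ≤ x ^ 9 * #(C h)) :
    (pairWeight H x i h - x ^ 6) * #(C h) ≤ #(nextCand H G R C i v h) := by
  -- The three losses: uniformity error, candidates excluded by `R`, and the vertex v itself.
  have hκ : x ^ 10 + 16 * x ^ 12 + x ^ 9 ≤ x ^ 6 := by
    have h6 : 0 < x ^ 6 := by positivity
    have e1 : x ^ 12 ≤ x ^ 6 * (1 / 2) ^ 6 := by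
      rw [show x ^ 12 = x ^ 6 * x ^ 6 by ring]; gcongr
    have e2 : x ^ 10 ≤ x ^ 6 * (1 / 2) ^ 4 := by
      rw [show x ^ 10 = x ^ 6 * x ^ 4 by ring]; gcongr
    have e3 : x ^ 9 ≤ x ^ 6 * (1 / 2) ^ 3 := by
      rw [show x ^ 9 = x ^ 6 * x ^ 3 by ring]; gcongr
    linarith
  have hκs := mul_le_mul_of_nonneg_right hκ (Nat.cast_nonneg (α := ℝ) #(C h))
  by_cases hadj : H.Adj i h
  · rw [pairRel_of_adj hadj] at hv
    have h1 : {y ∈ C h | G.Adj v y ∧ ¬ R v y} ⊆ nextCand H G R C i v h := by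
      intro y
      simp only [mem_nextCand, mem_filter, Compatible]
      tauto
    have h2 : (#{y ∈ C h | G.Adj v y ∧ ¬ R v y} : ℝ) ≤ #(nextCand H G R C i v h) := by
      exact_mod_cast card_le_card h1
    have h3 := sub_le_card_filter_and_not (r := G.Adj) (R := R) v (C h)
    have h4 : 0 ≤ x ^ 9 * #(C h) := by positivity
    have h5 := hR hadj
    linarith
  · rw [pairRel_of_not_adj hadj] at hv
    have h3 := relDeg_sub_one_le_card (fun y z => ¬ G.Adj y z) v (C h)
    have h1 : {y ∈ C h | ¬ G.Adj v y ∧ y ≠ v} ⊆ nextCand H G R C i v h := by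
      intro y
      simp only [mem_nextCand, mem_filter, Compatible]
      tauto
    have h2 : (#{y ∈ C h | ¬ G.Adj v y ∧ y ≠ v} : ℝ) ≤ #(nextCand H G R C i v h) := by
      exact_mod_cast card_le_card h1
    have h4 : 0 ≤ x ^ 12 * #(C h) := by positivity
    have h5 := h3.trans ((le_of_eq (by congr)).trans h2)
    linarith

/-- The edges of `H` among the vertices from `i` on. -/
noncomputable def laterEdges (H : SimpleGraph (Fin k)) (i : ℕ) : Finset (Fin k × Fin k) :=
  {q | i ≤ (q.1 : ℕ) ∧ q.1 < q.2 ∧ H.Adj q.1 q.2}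

theorem mem_laterEdges {i : ℕ} {q : Fin k × Fin k} :
    q ∈ laterEdges H i ↔ i ≤ (q.1 : ℕ) ∧ q.1 < q.2 ∧ H.Adj q.1 q.2 := by
  simp [laterEdges]

/-- The later edges at i leave the potential and become the degree terms of the averaging step, so
both kinds of term are controlled together. -/
theorem sum_laterEdges_succ_add_le :
    (∑ q ∈ laterEdges H (i + 1), relDens R (C q.1) (C q.2)) +
      ∑ h with i < h ∧ H.Adj i h, relDens R (C i) (C h) ≤
    ∑ q ∈ laterEdges H i, relDens R (C q.1) (C q.2) := by
  have h1 : ∑ h with i < h ∧ H.Adj i h, relDens R (C i) (C h) =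
      ∑ q ∈ (univ.filter fun h => i < h ∧ H.Adj i h).image (fun h => (i, h)),
        relDens R (C q.1) (C q.2) := by
    rw [sum_image]
    intro a _ b _ hab
    exact (Prod.mk.inj hab).2
  have hdisj : Disjoint (laterEdges H (i + 1))
      ((univ.filter fun h => i < h ∧ H.Adj i h).image fun h => (i, h)) := by
    rw [Finset.disjoint_left]
    intro q hq hq'
    obtain ⟨h, -, rfl⟩ := mem_image.1 hq'
    have := (mem_laterEdges.1 hq).1
    simp at this
  rw [h1, ← sum_union hdisj]
  refine sum_le_sum_of_subset_of_nonneg ?_ fun _ _ _ => relDens_nonneg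
  intro q hq
  rcases mem_union.1 hq with hq | hq
  · have := mem_laterEdges.1 hq
    exact mem_laterEdges.2 ⟨by omega, this.2⟩
  · obtain ⟨h, hh, rfl⟩ := mem_image.1 hq
    exact mem_laterEdges.2 ⟨le_rfl, (mem_filter.1 hh).2⟩

theorem exists_nextCand_bounds {M T : ℝ} (hk : 2 ≤ k) (hxk : x = 1 / k)
    (hG : IsUniformRel G.Adj x (x ^ 10) M) (hM : 1 ≤ M) (hMT : M ≤ x ^ 22 * T)
    (hsize : ∀ h, i ≤ h → T ≤ #(C h))
    (hΦ : ∑ q ∈ laterEdges H i, relDens R (C q.1) (C q.2) ≤ (1 + x) ^ (i : ℕ) * x ^ 12) :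
    ∃ v ∈ C i, (∀ h, i < h →
        (pairWeight H x i h - x ^ 6) * #(C h) ≤ #(nextCand H G R C i v h)) ∧
      ∑ q ∈ laterEdges H (i + 1), relDens R (nextCand H G R C i v q.1) (nextCand H G R C i v q.2)
        ≤ (1 + x) ^ ((i : ℕ) + 1) * x ^ 12 := by
  have hk0 : (2 : ℝ) ≤ k := by exact_mod_cast hk
  have hx : 0 < x := by rw [hxk]; positivity
  have hx1 : x ≤ 1 / 2 := by rw [hxk]; gcongr
  have hT0 : 0 < T := by
    by_contra! hcon
    have : x ^ 22 * T ≤ 0 := mul_nonpos_of_nonneg_of_nonpos (by positivity) hcon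
    linarith
  have hW : ∀ h, x ≤ pairWeight H x i h := fun h => le_pairWeight hx1
  obtain ⟨v, hv, hdeg, hpot⟩ := exists_vertex_potential_le (R := R) (r := pairRel H G i)
    (W := pairWeight H x i) (C := C)
    (D := C i) (T := T) hk hxk (by linarith) hMT (univ.filter fun h => i < h)
    (univ.filter fun h => i < h ∧ H.Adj i h) (laterEdges H (i + 1))
    (fun h hh => mem_filter.2 ⟨mem_univ _, (mem_filter.1 hh).2.1⟩)
    (fun q hq => by
      have hq' := mem_laterEdges.1 hq
      have h1 : i < q.1 := hq'.1
      exact ⟨mem_filter.2 ⟨mem_univ _, h1⟩, mem_filter.2 ⟨mem_univ _, h1.trans hq'.2.1⟩⟩)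
    (fun h => isUniformRel_pairRel hG) (fun h => pairRel_comm) hW
    (fun h hh => hsize h (mem_filter.1 hh).2.le) (hsize i le_rfl)
  have hF1 : x ^ 12 ≤ (1 + x) ^ (i : ℕ) * x ^ 12 :=
    le_mul_of_one_le_left (by positivity) (one_le_pow₀ (by linarith))
  have hF4 : (1 + x) ^ (i : ℕ) * x ^ 12 ≤ 4 * x ^ 12 := by
    have := one_add_inv_pow_le_four (k := k) (i := i) (by omega) i.2.le
    rw [← hxk] at this
    exact mul_le_mul_of_nonneg_right this (by positivity)
  have hX0 : 0 ≤ ∑ q ∈ laterEdges H (i + 1), relSum R {y ∈ C q.1 | pairRel H G i q.1 v y}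
      {y ∈ C q.2 | pairRel H G i q.2 v y} /
          (pairWeight H x i q.1 * pairWeight H x i q.2 * (#(C q.1) * #(C q.2))) :=
    sum_nonneg fun q _ => div_nonneg relSum_nonneg
      (mul_nonneg (mul_nonneg (hx.le.trans (hW _)) (hx.le.trans (hW _))) (by positivity))
  have hY0 : 0 ≤ ∑ h with i < h ∧ H.Adj i h, relDeg R v (C h) / #(C h) :=
    sum_nonneg fun q _ => div_nonneg (relDeg_nonneg _) (by positivity)
  obtain ⟨hY, hX⟩ := potential_step hx hx1 hX0 hY0 hF1 hF4
    (sum_laterEdges_succ_add_le.trans hΦ) hpot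
  have hT1 : 1 ≤ x ^ 9 * T := by
    have : x ^ 22 ≤ x ^ 9 := pow_le_pow_of_le_one hx.le (by linarith) (by norm_num)
    have := mul_le_mul_of_nonneg_right this hT0.le
    linarith
  have hcard : ∀ h, i < h →
      (pairWeight H x i h - x ^ 6) * #(C h) ≤ #(nextCand H G R C i v h) := by
    intro h hih
    have hs := hsize h hih.le
    have hs0 : (0 : ℝ) < #(C h) := hT0.trans_le hs
    refine pairWeight_sub_mul_le_card_nextCand hx hx1
      (hdeg h (mem_filter.2 ⟨mem_univ _, hih⟩)) (fun hadj => ?_) (hT1.trans (by gcongr))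
    have h1 : relDeg R v (C h) / #(C h) ≤ ∑ h with i < h ∧ H.Adj i h, relDeg R v (C h) / #(C h) :=
      single_le_sum (f := fun h => relDeg R v (C h) / (#(C h) : ℝ))
        (fun _ _ => div_nonneg (relDeg_nonneg _) (by positivity))
        (mem_filter.2 ⟨mem_univ _, hih, hadj⟩)
    exact (div_le_iff₀ hs0).1 (h1.trans hY)
  refine ⟨v, hv, hcard, ?_⟩
  have hx5 : x ^ 5 ≤ 1 / 2 := by
    have : x ^ 5 ≤ x ^ 1 := pow_le_pow_of_le_one hx.le (by linarith) (by norm_num)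
    linarith
  have h5 : 0 < 1 - x ^ 5 := by linarith
  have hcard5 : ∀ h, i < h →
      pairWeight H x i h * (1 - x ^ 5) * #(C h) ≤ #(nextCand H G R C i v h) := by
    intro h hih
    refine le_trans (mul_le_mul_of_nonneg_right ?_ (Nat.cast_nonneg _)) (hcard h hih)
    have := mul_le_mul_of_nonneg_right (hW h) (by positivity : 0 ≤ x ^ 5)
    have e : x ^ 6 = x * x ^ 5 := by ring
    linarith
  -- Deleting candidates cannot increase the number of `R`-pairs; only the denominators differ from
  -- the expected ones, each by a factor at least 1 - x^5.
  have hle : ∑ q ∈ laterEdges H (i + 1),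
      relDens R (nextCand H G R C i v q.1) (nextCand H G R C i v q.2) ≤
      (∑ q ∈ laterEdges H (i + 1), relSum R {y ∈ C q.1 | pairRel H G i q.1 v y}
      {y ∈ C q.2 | pairRel H G i q.2 v y} /
          (pairWeight H x i q.1 * pairWeight H x i q.2 * (#(C q.1) * #(C q.2)))) /
        (1 - x ^ 5) ^ 2 := by
    rw [sum_div]
    refine sum_le_sum fun q hq => ?_
    have hq' := mem_laterEdges.1 hq
    have h1 : i < q.1 := hq'.1
    have h2 : i < q.2 := h1.trans hq'.2.1
    have hs1 : (0 : ℝ) < #(C q.1) := hT0.trans_le (hsize _ h1.le)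
    have hs2 : (0 : ℝ) < #(C q.2) := hT0.trans_le (hsize _ h2.le)
    have hw1 : 0 < pairWeight H x i q.1 := hx.trans_le (hW _)
    have hw2 : 0 < pairWeight H x i q.2 := hx.trans_le (hW _)
    rw [relDens, div_div]
    refine div_le_div₀ relSum_nonneg (relSum_mono (nextCand_subset v) (nextCand_subset v))
      (by positivity) ?_
    calc _ = (pairWeight H x i q.1 * (1 - x ^ 5) * #(C q.1)) *
          (pairWeight H x i q.2 * (1 - x ^ 5) * #(C q.2)) := by ring
      _ ≤ _ := mul_le_mul (hcard5 _ h1) (hcard5 _ h2) (by positivity) (by positivity)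
  refine hle.trans ?_
  rw [div_le_iff₀ (by positivity)]
  refine hX.trans (le_of_eq ?_)
  ring

/-- Embedding between sets of small `R`-density with edges avoiding `R`. -/
theorem exists_compatible_of_sparse {α M T : ℝ}
    (hk : 2 ≤ k) (hxk : x = 1 / k) (hd : ∀ i : Fin k, #{j | j < i ∧ H.Adj j i} ≤ d)
    (hG : IsUniformRel G.Adj x (x ^ 10) M) (hM : 1 ≤ M) (hMT : M ≤ x ^ 22 * T)
    (hα : 0 < α) (hα1 : α ≤ x / 2) (U : Fin k → Finset V) {N : ℝ} (hN : 0 ≤ N)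
    (hT : T ≤ α ^ d * ((1 - x) ^ 2) ^ k * N) (hUN : ∀ h, N ≤ #(U h))
    (hU : ∀ h h', H.Adj h h' → relDens R (U h) (U h') ≤ x ^ 14) :
    ∃ f : Fin k → V, ∀ a b, a < b → Compatible H G (fun v y => G.Adj v y ∧ ¬ R v y) a b
      (f a) (f b) := by
  have hk0 : (2 : ℝ) ≤ k := by exact_mod_cast hk
  have hx : 0 < x := by rw [hxk]; positivity
  have hx1 : x ≤ 1 / 2 := by rw [hxk]; gcongr
  have hkx : (k : ℝ) * x = 1 := by rw [hxk]; field_simp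
  have hβ : 0 < (1 - x) ^ 2 := by
    have : (0 : ℝ) < 1 - x := by linarith
    positivity
  have hβ1 : (1 - x) ^ 2 ≤ 1 := pow_le_one₀ (by linarith) (by linarith)
  have hx6 : x ^ 6 ≤ x / 4 := by
    have : x ^ 6 ≤ x ^ 3 := pow_le_pow_of_le_one hx.le (by linarith) (by norm_num)
    nlinarith
  refine exists_map_of_greedy H G _ (fun i C => (∀ h : Fin k, i ≤ h →
    α ^ backDeg H i h * ((1 - x) ^ 2) ^ i * N ≤ #(C h)) ∧
    ∑ q ∈ laterEdges H i, relDens R (C q.1) (C q.2) ≤ (1 + x) ^ i * x ^ 12) U ⟨?_, ?_⟩ ?_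
  · intro h _
    simpa [backDeg_zero] using hUN h
  -- Initially the potential has at most k² terms, each at most x^14.
  · have h1 : ∑ q ∈ laterEdges H 0, relDens R (U q.1) (U q.2) ≤ ∑ _q ∈ laterEdges H 0, x ^ 14 :=
      sum_le_sum fun q hq => hU _ _ (mem_laterEdges.1 hq).2.2
    rw [sum_const, nsmul_eq_mul] at h1
    have h2 : #(laterEdges H 0) ≤ k * k := (card_le_univ _).trans (by simp)
    have h3 : (#(laterEdges H 0) : ℝ) ≤ k * k := by exact_mod_cast h2
    calc _ ≤ (#(laterEdges H 0) : ℝ) * x ^ 14 := h1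
      _ ≤ (k * k) * x ^ 14 := by gcongr
      _ = (k * x) ^ 2 * x ^ 12 := by ring
      _ = _ := by rw [hkx]; ring
  rintro i C ⟨hC, hΦ⟩
  have hsize : ∀ h : Fin k, i ≤ h → T ≤ #(C h) := fun h hh =>
    hT.trans (le_trans (mul_le_mul_of_nonneg_right
      (pow_mul_pow_le_backDeg hα (by linarith) hβ hβ1 hd (i := i) (h := h) hh) hN) (hC h hh))
  obtain ⟨v, hv, hcard, hsum⟩ := exists_nextCand_bounds hk hxk hG hM hMT hsize hΦ
  refine ⟨v, hv, nextCand H G R C i v, ⟨fun h hh => ?_, hsum⟩, fun h _ =>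
    ⟨filter_subset _ _, fun y hy => (mem_filter.1 hy).2⟩⟩
  have hih : i < h := hh
  have hc := hcard h hih
  refine backDeg_bound_succ hα hβ hβ1 hN (hC h hih.le) (fun hadj => ?_) (fun hadj => ?_)
  · refine le_trans (mul_le_mul_of_nonneg_right ?_ (Nat.cast_nonneg _)) hc
    rw [pairWeight, if_pos hadj]
    linarith
  · refine le_trans (mul_le_mul_of_nonneg_right ?_ (Nat.cast_nonneg _)) hc
    rw [pairWeight, if_neg hadj]
    nlinarith

end Sparse

/-! ### The dichotomy and the theorem for pseudo-random graphs. -/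

section Core

open Finset
open scoped Classical

/-- The left factor is a fixed power of 1/k, while the right side is at least e^(-4) > 1/64: all
non-edges together cost only a bounded factor. -/
theorem pow_six_le_one_sub_pow {k : ℕ} (hk : 2 ≤ k) :
    (1 / k : ℝ) ^ 6 ≤ ((1 - 1 / k : ℝ) ^ 2) ^ k := by
  have hk0 : (2 : ℝ) ≤ k := by exact_mod_cast hk
  have hx : (0 : ℝ) < 1 / k := by positivity
  have hx1 : (1 : ℝ) / k ≤ 1 / 2 := by gcongr
  have hkx : (k : ℝ) * (1 / k) = 1 := by field_simp
  set x : ℝ := 1 / k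
  have h1 : Real.exp (-(2 * x)) ≤ 1 - x := by
    rw [Real.exp_neg, inv_le_comm₀ (Real.exp_pos _) (by linarith)]
    refine le_trans ?_ (Real.add_one_le_exp (2 * x))
    rw [inv_le_iff_one_le_mul₀ (by linarith)]
    nlinarith
  have h2 : Real.exp (-4) ≤ ((1 - x) ^ 2) ^ k := by
    calc Real.exp (-4) = (Real.exp (-(2 * x)) ^ 2) ^ k := by
          rw [← pow_mul, ← Real.exp_nat_mul]
          congr 1
          push_cast
          linear_combination (4 : ℝ) * hkx
      _ ≤ _ := by gcongr
  have h3 : Real.exp 4 ≤ 64 := by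
    have : Real.exp 4 = Real.exp 1 ^ 4 := by rw [← Real.exp_nat_mul]; norm_num
    rw [this]
    calc Real.exp 1 ^ 4 ≤ (2.7182818286 : ℝ) ^ 4 := by
          gcongr; exact Real.exp_one_lt_d9.le
      _ ≤ 64 := by norm_num
  calc x ^ 6 ≤ (1 / 2) ^ 6 := by gcongr
    _ = (64 : ℝ)⁻¹ := by norm_num
    _ ≤ (Real.exp 4)⁻¹ := by gcongr
    _ = Real.exp (-4) := (Real.exp_neg 4).symm
    _ ≤ _ := h2

theorem exists_color_of_isUniformRel {k d t : ℕ} (hk : 2 ≤ k) (hd : 2 ≤ d)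
    (ht : 2 ^ t ≤ 2 * k) {V : Type*} [Fintype V] (G : SimpleGraph V) {M : ℝ} (hM : 1 ≤ M)
    (hG : IsUniformRel G.Adj (1 / k) ((1 / k : ℝ) ^ 10) M)
    (hV : M * k ^ (22 + 23 * d) * (2 * k ^ (23 * d)) ^ t ≤ Fintype.card V)
    (C : G.EdgeLabeling (Fin 2)) :
    ∃ i : Fin 2, ∀ (W : Type*) [Fintype W] (H : SimpleGraph W), Fintype.card W = k →
      IsDegenerate H d → H.Colorable (2 ^ t) → HasInducedCopyInColor G C i H := by
  have hk0 : (2 : ℝ) ≤ k := by exact_mod_cast hk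
  have hx : (0 : ℝ) < 1 / k := by positivity
  have hx1 : (1 : ℝ) / k ≤ 1 / 2 := by gcongr
  have hkx : (k : ℝ) * (1 / k) = 1 := by field_simp
  obtain ⟨x, hxk⟩ : ∃ x : ℝ, x = 1 / k := ⟨_, rfl⟩
  have hβ : x ^ 6 ≤ ((1 - x) ^ 2) ^ k := by
    rw [hxk]; exact pow_six_le_one_sub_pow hk
  rw [← hxk] at hG hx hx1 hkx
  have hρ0 : 0 < x ^ (23 * d) := by positivity
  have hρ1 : x ^ (23 * d) ≤ 1 := pow_le_one₀ hx.le (by linarith)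
  have hα : 0 < x ^ 18 := by positivity
  have hα1 : x ^ 18 ≤ x / 2 := by
    have : x ^ 18 ≤ x ^ 2 := pow_le_pow_of_le_one hx.le (by linarith) (by norm_num)
    nlinarith
  -- The exponent 23d = 18d + 5d: 18d pays for the d edge steps, and 5d ≥ 10 for the non-edges (x^6)
  -- and the factor 2k.
  have hρα : 2 * k * x ^ (23 * d) ≤ (x ^ 18) ^ d * ((1 - x) ^ 2) ^ k := by
    calc 2 * k * x ^ (23 * d) = (x ^ 18) ^ d * (2 * k * x ^ (5 * d)) := by
          rw [← pow_mul]
          have : 23 * d = 18 * d + 5 * d := by ring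
          rw [this, pow_add]; ring
      _ ≤ (x ^ 18) ^ d * (2 * k * x ^ 10) := by
          have : x ^ (5 * d) ≤ x ^ 10 := pow_le_pow_of_le_one hx.le (by linarith) (by omega)
          gcongr
      _ = (x ^ 18) ^ d * (x ^ 6 * (2 * x ^ 3)) := by linear_combination (x ^ 18) ^ d * 2 * x ^ 9 * hkx
      _ ≤ (x ^ 18) ^ d * (x ^ 6 * 1) := by
          have : x ^ 3 ≤ (1 / 2) ^ 3 := by gcongr
          gcongr
          linarith
      _ ≤ _ := by rw [mul_one]; gcongr
  set ρ := x ^ (23 * d) with hρ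
  set α := x ^ 18 with hαdef
  -- Chosen so that ρN = M / x^22, the smallest set size at which the averaging step applies.
  set N := M / (x ^ 22 * ρ) with hN
  have hM0 : 0 < M := by linarith
  have hN0 : 0 < N := by positivity
  have hρN : ρ * N = M / x ^ 22 := by rw [hN]; field_simp
  have hVN : N * (2 / ρ) ^ t ≤ #(univ : Finset V) := by
    rw [card_univ]
    refine le_trans (le_of_eq ?_) hV
    have hinv : (k : ℝ) = x⁻¹ := by rw [hxk]; simp
    rw [hN, hρ, hinv]
    simp only [pow_add, inv_pow]
    field_simp
  have hx22 : x ^ 22 ≤ 1 := pow_le_one₀ hx.le (by linarith)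
  have hMle : M ≤ M / x ^ 22 := by
    rw [le_div_iff₀ (by positivity)]
    exact mul_le_of_le_one_right hM0.le hx22
  have hMx : x ^ 22 * (M / x ^ 22) = M := by field_simp
  let R := (C.labelGraph 0).Adj
  have hblue : ∀ v y, (G.Adj v y ∧ ¬ R v y) → (C.labelGraph 1).Adj v y := by
    rintro v y ⟨h1, h2⟩
    rw [SimpleGraph.EdgeLabeling.labelGraph_adj]
    simp only [R, SimpleGraph.EdgeLabeling.labelGraph_adj, not_exists] at h2
    refine ⟨h1, ?_⟩
    have := h2 h1
    omega
  by_cases hdense : ∃ U : Finset V, N ≤ #U ∧ ∀ A B, A ⊆ U → B ⊆ U → ρ * #U ≤ #A → ρ * #U ≤ #B →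
      α * #A * #B ≤ relSum R A B
  · obtain ⟨U, hU, hUd⟩ := hdense
    refine ⟨0, fun W _ H hW hH _ => ?_⟩
    obtain ⟨e, he⟩ := hH.exists_equiv hW
    have hTM : M / x ^ 22 ≤ ρ * #U := by rw [← hρN]; gcongr
    have hTx : 1 / (ρ * #U) ≤ x ^ 22 := by
      have hpos : 0 < M / x ^ 22 := by positivity
      rw [div_le_iff₀ (hpos.trans_le hTM)]
      calc 1 ≤ M := hM
        _ = x ^ 22 * (M / x ^ 22) := hMx.symm
        _ ≤ _ := by gcongr
    have hGn := hG.not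
    rw [hxk] at hGn
    obtain ⟨f, hf⟩ := exists_compatible_of_dense (H := H.comap e.symm) G R hk he hGn hM0
      (hMle.trans hTM) (by
        rw [← hxk]
        have h1 : x ^ 10 ≤ x ^ 3 := pow_le_pow_of_le_one hx.le (by linarith) (by norm_num)
        have h2 : x ^ 22 ≤ x ^ 3 := pow_le_pow_of_le_one hx.le (by linarith) (by norm_num)
        have h3 : (1 : ℝ) / (2 * k) = x / 2 := by rw [hxk]; field_simp
        rw [h3]
        nlinarith) hα (by linarith) U hUd (by
        rw [← hxk]
        calc 2 * k * (ρ * #U) = (2 * k * ρ) * #U := by ring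
          _ ≤ _ := by gcongr)
    exact hasInducedCopyInColor_of_compatible H G C 0 e f hf
  · push Not at hdense
    obtain ⟨F, hF, hF'⟩ := exists_sparse_family (R := R) (fun y z => (C.labelGraph 0).adj_comm y z)
      hα hρ0 hρ1 hN0 (fun U hU => by
        obtain ⟨A, B, h1, h2, h3, h4, h5⟩ := hdense U hU
        exact ⟨A, B, h1, h2, h3, h4, h5.le⟩) t univ hVN
    refine ⟨1, fun W _ H hW hH hcol => ?_⟩
    obtain ⟨e, he⟩ := hH.exists_equiv hW
    obtain ⟨c⟩ := hcol
    -- A vertex starts with the sparse set indexed by its colour, so edges of H run between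
    -- different sets. With α = x^18 and 2^t ≤ 2k their red density is at most 8 x^17 ≤ x^14.
    obtain ⟨f, hf⟩ := exists_compatible_of_sparse (H := H.comap e.symm) (G := G) (R := R) hk hxk he
      hG hM (T := M / x ^ 22) hMx.ge hα hα1 (fun h => F (c (e.symm h))) hN0.le (by
        rw [← hρN]
        gcongr
        refine le_trans ?_ hρα
        refine le_mul_of_one_le_left hρ0.le ?_
        linarith) (fun h => (hF _ (c (e.symm h)).2).2) (fun h h' hadj => by
        have hne : c (e.symm h) ≠ c (e.symm h') := c.valid hadj
        have h1 := hF' _ (c (e.symm h)).2 _ (c (e.symm h')).2 (fun h => hne (Fin.ext h))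
        have h2 : (0 : ℝ) < #(F (c (e.symm h))) := hN0.trans_le (hF _ (c (e.symm h)).2).2
        have h3 : (0 : ℝ) < #(F (c (e.symm h'))) := hN0.trans_le (hF _ (c (e.symm h')).2).2
        rw [relDens, div_le_iff₀ (by positivity), ← mul_assoc]
        refine h1.trans ?_
        gcongr
        have h4 : (2 : ℝ) ^ t ≤ 2 * k := by exact_mod_cast ht
        calc 4 * 2 ^ t * α ≤ 4 * (2 * k) * α := by gcongr
          _ = x ^ 14 * (8 * x ^ 3) := by rw [hαdef]; linear_combination 8 * x ^ 17 * hkx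
          _ ≤ x ^ 14 * 1 := by
              have : x ^ 3 ≤ (1 / 2) ^ 3 := by gcongr
              gcongr
              linarith
          _ = x ^ 14 := mul_one _)
    exact hasInducedCopyInColor_of_compatible H G C 1 e f fun a b hab =>
      ⟨fun h => hblue _ _ ((hf a b hab).1 h), (hf a b hab).2⟩

/-- Pseudo-random graphs have the induced Ramsey property for degenerate graphs. -/
theorem exists_color_of_isPseudoRandom {k d χ : ℕ} (hk : 2 ≤ k) (hd : 2 ≤ d) (hχ : 2 ≤ χ)
    {V : Type*} [Fintype V] (G : SimpleGraph V)
    (hn : (k : ℝ) ^ (1260 * d * Real.logb 2 χ) ≤ Fintype.card V)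
    (hG : IsPseudoRandom G (1 / (k : ℝ)) ((Fintype.card V : ℝ) ^ (9 / 10 : ℝ)))
    (C : G.EdgeLabeling (Fin 2)) :
    ∃ i : Fin 2, ∀ (W : Type*) [Fintype W] (H : SimpleGraph W), Fintype.card W = k →
      IsDegenerate H d → H.chromaticNumber ≤ (χ : ℕ∞) → HasInducedCopyInColor G C i H := by
  have hk0 : (2 : ℝ) ≤ k := by exact_mod_cast hk
  have hχ0 : (2 : ℝ) ≤ χ := by exact_mod_cast hχ
  have hd0 : (2 : ℝ) ≤ d := by exact_mod_cast hd
  set n : ℝ := (Fintype.card V : ℝ) with hndef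
  set L := Real.logb 2 χ with hL
  have hL1 : 1 ≤ L := by
    rw [hL, Real.le_logb_iff_rpow_le (by norm_num) (by linarith)]
    simpa using hχ0
  have hn1 : 1 ≤ n := le_trans (Real.one_le_rpow (by linarith) (by positivity)) hn
  -- H is always k-colourable; capping χ at k secures 2^t ≤ 2k without bounding χ itself.
  set χ' := min χ k with hχ'
  have hχ'2 : 2 ≤ χ' := le_min hχ hk
  set t := Nat.clog 2 χ' with ht
  have ht1 : 1 ≤ t := Nat.clog_pos (by norm_num) hχ'2
  have hpred : 2 ^ (t - 1) < χ' := by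
    have := Nat.pow_pred_clog_lt_self (b := 2) (by norm_num) (x := χ') hχ'2
    simpa [Nat.pred_eq_sub_one, ht] using this
  have h2t : 2 ^ t ≤ 2 * k := by
    have h1 : 2 ^ t = 2 * 2 ^ (t - 1) := by
      rw [← pow_succ']; congr 1; omega
    have h2 : χ' ≤ k := min_le_right _ _
    omega
  have htL : (t : ℝ) ≤ 2 * L := by
    have h1 : ((t - 1 : ℕ) : ℝ) ≤ L := by
      rw [hL, Real.le_logb_iff_rpow_le (by norm_num) (by linarith), Real.rpow_natCast]
      have h2 : 2 ^ (t - 1) ≤ χ := hpred.le.trans (min_le_left _ _)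
      exact_mod_cast h2
    rw [Nat.cast_sub ht1] at h1
    push_cast at h1
    linarith
  -- The size for which the pseudo-randomness error n^0.9 equals x^10 M.
  set M : ℝ := n ^ (9 / 10 : ℝ) * k ^ 10 with hM
  have hM1 : 1 ≤ M := one_le_mul_of_one_le_of_one_le
    (Real.one_le_rpow hn1 (by norm_num)) (one_le_pow₀ (by linarith))
  have hU : IsUniformRel G.Adj (1 / k) ((1 / k : ℝ) ^ 10) M := by
    refine hG.isUniformRel (by positivity) (by linarith) (le_of_eq ?_)
    rw [hM]
    field_simp
  -- All powers of k must fit into n^(1/10). Their exponent is at most 63dt ≤ 126 d log χ, a tenth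
  -- of 1260 d log χ.
  have hsize : M * k ^ (22 + 23 * d) * (2 * k ^ (23 * d)) ^ t ≤ Fintype.card V := by
    have h1 : (k : ℝ) ^ 10 * k ^ (22 + 23 * d) * (2 * k ^ (23 * d)) ^ t ≤ (k : ℝ) ^ (63 * d * t) := by
      have e1 : (2 : ℝ) * k ^ (23 * d) ≤ k ^ (24 * d) := by
        calc (2 : ℝ) * k ^ (23 * d) ≤ k ^ d * k ^ (23 * d) := by
              gcongr
              calc (2 : ℝ) ≤ k ^ 1 := by simpa using hk0
                _ ≤ k ^ d := pow_le_pow_right₀ (by linarith) (by omega)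
          _ = _ := by rw [← pow_add]; congr 1; ring
      calc (k : ℝ) ^ 10 * k ^ (22 + 23 * d) * (2 * k ^ (23 * d)) ^ t
          ≤ (k : ℝ) ^ 10 * k ^ (22 + 23 * d) * (k ^ (24 * d)) ^ t := by gcongr
        _ = (k : ℝ) ^ (10 + (22 + 23 * d) + 24 * d * t) := by
          rw [pow_add _ (10 + (22 + 23 * d)), pow_add _ 10, pow_mul _ (24 * d)]
        _ ≤ _ := by
          refine pow_le_pow_right₀ (by linarith) ?_
          have : d ≤ d * t := Nat.le_mul_of_pos_right d ht1
          nlinarith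
    have h2 : (k : ℝ) ^ (63 * d * t) ≤ n ^ (1 / 10 : ℝ) := by
      calc (k : ℝ) ^ (63 * d * t) = (k : ℝ) ^ ((63 * d * t : ℕ) : ℝ) := (Real.rpow_natCast _ _).symm
        _ ≤ (k : ℝ) ^ ((1260 * d * L) * (1 / 10)) := by
          refine Real.rpow_le_rpow_of_exponent_le (by linarith) ?_
          push_cast
          have := mul_le_mul_of_nonneg_left htL (by positivity : (0 : ℝ) ≤ 63 * d)
          linarith
        _ = ((k : ℝ) ^ (1260 * d * L)) ^ (1 / 10 : ℝ) := Real.rpow_mul (by linarith) _ _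
        _ ≤ _ := Real.rpow_le_rpow (by positivity) hn (by norm_num)
    calc M * k ^ (22 + 23 * d) * (2 * k ^ (23 * d)) ^ t
        = n ^ (9 / 10 : ℝ) * ((k : ℝ) ^ 10 * k ^ (22 + 23 * d) * (2 * k ^ (23 * d)) ^ t) := by
          rw [hM]; ring
      _ ≤ n ^ (9 / 10 : ℝ) * n ^ (1 / 10 : ℝ) := by
          have := h1.trans h2
          gcongr
      _ = n := by
          rw [← Real.rpow_add (by linarith)]
          norm_num
  obtain ⟨i, hi⟩ := exists_color_of_isUniformRel hk hd h2t G hM1 hU hsize C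
  refine ⟨i, fun W _ H hW hH hχH => hi W H hW hH ?_⟩
  have hcol : H.Colorable χ' := by
    rcases min_choice χ k with h | h
    · rw [hχ', h]; exact SimpleGraph.chromaticNumber_le_iff_colorable.1 hχH
    · rw [hχ', h, ← hW]; exact H.colorable_of_fintype
  exact hcol.mono (Nat.le_pow_clog (by norm_num) _)

end Core

/-! ### An explicit pseudo-random graph over a prime field. -/

section Construction

open Finset
open scoped Classical

variable {q : ℕ} {V : Type*}

/-- The incidence-type relation `a c + b + d ∈ S` between points `(a, b)` and `(c, d)` of the
affine plane over `ZMod q`. -/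
def incidenceRel (φ : V ≃ ZMod q × ZMod q) (S : Finset (ZMod q)) (x y : V) : Prop :=
  (φ x).1 * (φ y).1 + (φ x).2 + (φ y).2 ∈ S

variable {φ : V ≃ ZMod q × ZMod q} {S : Finset (ZMod q)}

theorem incidenceRel_comm (x y : V) : incidenceRel φ S x y ↔ incidenceRel φ S y x := by
  unfold incidenceRel
  rw [show (φ x).1 * (φ y).1 + (φ x).2 + (φ y).2 = (φ y).1 * (φ x).1 + (φ y).2 + (φ x).2 by ring]

/-- A first coordinate and a value in S determine the second coordinate. The lower bound suffices,
since the first moment enters the variance with a negative sign. -/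
theorem le_relDeg_incidenceRel_univ [Fintype V] [NeZero q] (y : V) :
    (q : ℝ) * #S ≤ relDeg (incidenceRel φ S) y univ := by
  have h : #(univ ×ˢ S : Finset (ZMod q × ZMod q)) ≤ #{x : V | incidenceRel φ S y x} := by
    refine card_le_card_of_injOn
      (fun z => φ.symm (z.1, z.2 - (φ y).1 * z.1 - (φ y).2)) ?_ ?_
    · intro z hz
      have hz' : z.2 ∈ S := (mem_product.1 hz).2
      refine mem_coe.2 (mem_filter.2 ⟨mem_univ _, ?_⟩)
      simpa [incidenceRel] using hz'
    · rintro ⟨a, s⟩ _ ⟨a', s'⟩ _ h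
      have h1 := φ.symm.injective h
      simp only [Prod.mk.injEq] at h1 ⊢
      obtain ⟨rfl, h2⟩ := h1
      exact ⟨rfl, by linear_combination h2⟩
  rw [card_product, card_univ, ZMod.card] at h
  unfold relDeg
  exact_mod_cast h

/-- Points y and y' with different first coordinates give two independent linear equations, so x is
determined by its two values in S. -/
theorem card_incidenceRel_inter_le [Fintype V] [Fact q.Prime] {y y' : V} (h : (φ y).1 ≠ (φ y').1) :
    #{x : V | incidenceRel φ S x y ∧ incidenceRel φ S x y'} ≤ #S * #S := by
  rw [← card_product]
  refine card_le_card_of_injOn (fun x => ((φ x).1 * (φ y).1 + (φ x).2 + (φ y).2,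
    (φ x).1 * (φ y').1 + (φ x).2 + (φ y').2)) ?_ ?_
  · intro x hx
    exact mem_product.2 (mem_filter.1 hx).2
  · intro x _ x' _ hxx'
    obtain ⟨h1, h2⟩ := Prod.mk.inj hxx'
    have h3 : ((φ x).1 - (φ x').1) * ((φ y).1 - (φ y').1) = 0 := by
      linear_combination h1 - h2
    have h4 : (φ x).1 = (φ x').1 :=
      sub_eq_zero.1 ((mul_eq_zero.1 h3).resolve_right (sub_ne_zero.2 h))
    refine φ.injective (Prod.ext h4 ?_)
    rw [h4] at h1
    linear_combination h1

/-- Expand the square over pairs (y, y'). Pairs with equal first coordinates are bounded trivially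
by q², but each y has at most q such partners. -/
theorem sum_sq_relDeg_incidenceRel_le [Fintype V] [Fact q.Prime] (B : Finset V) :
    ∑ x, relDeg (incidenceRel φ S) x B ^ 2 ≤ (#B : ℝ) ^ 2 * #S ^ 2 + #B * q ^ 3 := by
  have h1 : ∀ x, relDeg (incidenceRel φ S) x B ^ 2 =
      ∑ y ∈ B, ∑ y' ∈ B, if incidenceRel φ S x y ∧ incidenceRel φ S x y' then (1 : ℝ) else 0 := by
    intro x
    rw [sq, relDeg_eq_sum, sum_mul_sum]
    refine sum_congr rfl fun y _ => sum_congr rfl fun y' _ => ?_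
    by_cases h1 : incidenceRel φ S x y <;> by_cases h2 : incidenceRel φ S x y' <;> simp [h1, h2]
  have hcard : Fintype.card V = q * q := by
    rw [Fintype.card_congr φ, Fintype.card_prod, ZMod.card]
  have h2 : ∀ y y' : V, ∑ x, (if incidenceRel φ S x y ∧ incidenceRel φ S x y' then (1 : ℝ) else 0) ≤
      (#S : ℝ) ^ 2 + if (φ y).1 = (φ y').1 then (q : ℝ) ^ 2 else 0 := by
    intro y y'
    have e : ∑ x, (if incidenceRel φ S x y ∧ incidenceRel φ S x y' then (1 : ℝ) else 0) =
        #{x : V | incidenceRel φ S x y ∧ incidenceRel φ S x y'} := by simp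
    rw [e]
    split_ifs with h
    · have h3 : #{x : V | incidenceRel φ S x y ∧ incidenceRel φ S x y'} ≤ q * q :=
        (card_le_univ _).trans hcard.le
      have h4 : (#{x : V | incidenceRel φ S x y ∧ incidenceRel φ S x y'} : ℝ) ≤ q * q := by
        exact_mod_cast h3
      nlinarith [sq_nonneg (#S : ℝ)]
    · have h3 : (#{x : V | incidenceRel φ S x y ∧ incidenceRel φ S x y'} : ℝ) ≤ #S * #S := by
        exact_mod_cast card_incidenceRel_inter_le h
      linarith
  have h3 : ∀ y : V, (#{y' ∈ B | (φ y).1 = (φ y').1} : ℝ) ≤ q := by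
    intro y
    have : #{y' ∈ B | (φ y).1 = (φ y').1} ≤ #(univ : Finset (ZMod q)) := by
      refine card_le_card_of_injOn (fun y' => (φ y').2) (by simp) ?_
      intro z hz z' hz' h
      have e1 := (mem_filter.1 hz).2
      have e2 := (mem_filter.1 hz').2
      exact φ.injective (Prod.ext (e1.symm.trans e2) h)
    rw [card_univ, ZMod.card] at this
    exact_mod_cast this
  simp only [h1]
  rw [Finset.sum_comm]
  have h4 : ∀ y ∈ B, ∑ x, ∑ y' ∈ B,
      (if incidenceRel φ S x y ∧ incidenceRel φ S x y' then (1 : ℝ) else 0) ≤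
      #B * (#S : ℝ) ^ 2 + q ^ 3 := by
    intro y _
    rw [Finset.sum_comm]
    refine (sum_le_sum fun y' _ => h2 y y').trans ?_
    rw [sum_add_distrib, sum_const, nsmul_eq_mul, ← sum_filter, sum_const, nsmul_eq_mul]
    have := mul_le_mul_of_nonneg_right (h3 y) (by positivity : (0 : ℝ) ≤ (q : ℝ) ^ 2)
    linarith
  refine (sum_le_sum h4).trans ?_
  rw [sum_const, nsmul_eq_mul]
  exact le_of_eq (by ring)

/-- Cauchy–Schwarz over A, with the second moment bounding the variance of degrees into B. -/
theorem abs_relSum_incidenceRel_sub_le [Fintype V] [Fact q.Prime] (A B : Finset V) :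
    |relSum (incidenceRel φ S) A B - #S / q * #A * #B| ≤ √((#A : ℝ) * #B) * √((q : ℝ) ^ 3) := by
  have hq : (0 : ℝ) < q := by exact_mod_cast (Fact.out : q.Prime).pos
  have hcard : Fintype.card V = q * q := by
    rw [Fintype.card_congr φ, Fintype.card_prod, ZMod.card]
  set f : V → ℝ := fun x => relDeg (incidenceRel φ S) x B with hf
  set m : ℝ := #S / q * #B with hm
  have hsum : (#B : ℝ) * (q * #S) ≤ ∑ x, f x := by
    change _ ≤ relSum (incidenceRel φ S) univ B
    rw [relSum_comm incidenceRel_comm]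
    have := Finset.card_nsmul_le_sum B (fun y => relDeg (incidenceRel φ S) y univ) (q * #S)
      fun y _ => le_relDeg_incidenceRel_univ y
    rwa [nsmul_eq_mul] at this
  have hvar : ∑ x, (f x - m) ^ 2 ≤ #B * q ^ 3 := by
    have h1 : ∑ x, (f x - m) ^ 2 = ∑ x, f x ^ 2 - 2 * m * ∑ x, f x + q * q * m ^ 2 := by
      simp only [sub_sq, sum_add_distrib, sum_sub_distrib, sum_const, card_univ, hcard,
        nsmul_eq_mul, mul_sum]
      push_cast
      congr 2
      exact sum_congr rfl fun x _ => by ring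
    have h2 := sum_sq_relDeg_incidenceRel_le (φ := φ) (S := S) B
    have hm0 : 0 ≤ 2 * m := by positivity
    have h3 := mul_le_mul_of_nonneg_left hsum hm0
    have h4 : 2 * m * (#B * (q * #S)) = 2 * ((#B : ℝ) ^ 2 * #S ^ 2) := by
      rw [hm]; field_simp
    have h5 : q * q * m ^ 2 = (#B : ℝ) ^ 2 * #S ^ 2 := by
      rw [hm]; field_simp
    linarith
  have h6 : relSum (incidenceRel φ S) A B - #S / q * #A * #B = ∑ x ∈ A, (f x - m) := by
    rw [sum_sub_distrib, sum_const, nsmul_eq_mul, hm]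
    change _ = relSum (incidenceRel φ S) A B - _
    ring
  rw [h6, ← Real.sqrt_mul (by positivity)]
  refine Real.abs_le_sqrt ?_
  calc (∑ x ∈ A, (f x - m)) ^ 2 ≤ #A * ∑ x ∈ A, (f x - m) ^ 2 := sq_sum_le_card_mul_sum_sq
    _ ≤ #A * ∑ x, (f x - m) ^ 2 := by
        refine mul_le_mul_of_nonneg_left ?_ (Nat.cast_nonneg _)
        exact sum_le_sum_of_subset_of_nonneg (subset_univ _) fun _ _ _ => sq_nonneg _
    _ ≤ #A * (#B * q ^ 3) := by gcongr
    _ = _ := by ring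

/-- The graph of the incidence relation, without loops. -/
def incidenceGraph (φ : V ≃ ZMod q × ZMod q) (S : Finset (ZMod q)) : SimpleGraph V where
  Adj x y := x ≠ y ∧ incidenceRel φ S x y
  symm := ⟨fun x y h => ⟨h.1.symm, (incidenceRel_comm x y).1 h.2⟩⟩
  loopless := ⟨fun _ h => h.1 rfl⟩

/-- Only loops differ, at most |A ∩ B| of them, and |A ∩ B| is at most the geometric mean of |A| and
|B|. -/
theorem abs_relSum_incidenceGraph_sub_le (A B : Finset V) :
    |relSum (incidenceGraph φ S).Adj A B - relSum (incidenceRel φ S) A B| ≤ √((#A : ℝ) * #B) := by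
  have h1 : ∀ x, relDeg (incidenceGraph φ S).Adj x B ≤ relDeg (incidenceRel φ S) x B := by
    intro x
    have : #{y ∈ B | (incidenceGraph φ S).Adj x y} ≤ #{y ∈ B | incidenceRel φ S x y} :=
      card_le_card fun y hy =>
        mem_filter.2 ⟨(mem_filter.1 hy).1, (mem_filter.1 hy).2.2⟩
    unfold relDeg
    exact_mod_cast this
  have h2 : ∀ x, relDeg (incidenceRel φ S) x B ≤
      relDeg (incidenceGraph φ S).Adj x B + if x ∈ B then 1 else 0 := by
    intro x
    have : #{y ∈ B | incidenceRel φ S x y} ≤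
        #{y ∈ B | (incidenceGraph φ S).Adj x y} + #{y ∈ B | x = y} := by
      refine (card_le_card fun y hy => ?_).trans (card_union_le _ _)
      by_cases hxy : x = y
      · exact mem_union_right _ (mem_filter.2 ⟨(mem_filter.1 hy).1, hxy⟩)
      · exact mem_union_left _ (mem_filter.2 ⟨(mem_filter.1 hy).1, hxy, (mem_filter.1 hy).2⟩)
    rw [Finset.filter_eq] at this
    have h3 : #(if x ∈ B then {x} else ∅ : Finset V) = if x ∈ B then 1 else 0 := by
      split_ifs <;> simp
    rw [h3] at this
    unfold relDeg
    exact_mod_cast this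
  have h3 : relSum (incidenceGraph φ S).Adj A B ≤ relSum (incidenceRel φ S) A B :=
    sum_le_sum fun x _ => h1 x
  have h4 : relSum (incidenceRel φ S) A B ≤ relSum (incidenceGraph φ S).Adj A B + #(A ∩ B) := by
    refine (sum_le_sum fun x _ => h2 x).trans (le_of_eq ?_)
    rw [sum_add_distrib, ← sum_filter, sum_const, filter_mem_eq_inter]
    simp [relSum]
  have h5 : (#(A ∩ B) : ℝ) ≤ √((#A : ℝ) * #B) := by
    refine Real.le_sqrt_of_sq_le ?_
    rw [sq]
    have hA : (#(A ∩ B) : ℝ) ≤ #A := by exact_mod_cast card_le_card inter_subset_left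
    have hB : (#(A ∩ B) : ℝ) ≤ #B := by exact_mod_cast card_le_card inter_subset_right
    gcongr
  rw [abs_le]
  constructor <;> linarith [Real.sqrt_nonneg ((#A : ℝ) * #B)]

theorem exists_isPseudoRandom {k q : ℕ} (hk : 1 ≤ k) (hq : q.Prime) (hq81 : 81 ≤ q) :
    ∃ G : SimpleGraph (Fin (q * q)),
      IsPseudoRandom G (1 / (k : ℝ)) (((q * q : ℕ) : ℝ) ^ (9 / 10 : ℝ)) := by
  have : Fact q.Prime := ⟨hq⟩
  have hcard : Fintype.card (ZMod q × ZMod q) = q * q := by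
    rw [Fintype.card_prod, ZMod.card]
  let φ : Fin (q * q) ≃ ZMod q × ZMod q := (Fintype.equivFinOfCardEq hcard).symm
  -- Rounding q/k down puts the density within 1/q of 1/k; as √(|A||B|) ≤ q², this adds only q to
  -- the error.
  obtain ⟨S, -, hS⟩ := Finset.exists_subset_card_eq (s := (univ : Finset (ZMod q))) (n := q / k)
    (by rw [card_univ, ZMod.card]; exact Nat.div_le_self q k)
  refine ⟨incidenceGraph φ S, fun A B hA hB => ?_⟩
  have hq0 : (0 : ℝ) < q := by exact_mod_cast hq.pos
  have hq81' : (81 : ℝ) ≤ q := by exact_mod_cast hq81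
  have hk0 : (0 : ℝ) < k := by exact_mod_cast hk
  have hA0 : (0 : ℝ) < #A := by exact_mod_cast hA.card_pos
  have hB0 : (0 : ℝ) < #B := by exact_mod_cast hB.card_pos
  set s := √((#A : ℝ) * #B) with hs
  have hs0 : 0 < s := Real.sqrt_pos.2 (by positivity)
  have hss : s * s = #A * #B := Real.mul_self_sqrt (by positivity)
  have hsq : s ≤ q * q := by
    have h1 : ∀ X : Finset (Fin (q * q)), (#X : ℝ) ≤ q * q := fun X => by
      have : #X ≤ q * q := (card_le_univ X).trans (by simp)
      exact_mod_cast this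
    rw [hs, Real.sqrt_le_left (by positivity), sq]
    exact mul_le_mul (h1 A) (h1 B) hB0.le (by positivity)
  have hp : |(#S : ℝ) / q - 1 / k| ≤ 1 / q := by
    have h1 : (#S : ℝ) * k ≤ q := by rw [hS]; exact_mod_cast Nat.div_mul_le_self q k
    have h2 : (q : ℝ) ≤ #S * k + k := by
      rw [hS]
      have := Nat.lt_div_mul_add (a := q) (b := k) hk
      exact_mod_cast this.le
    have h3 : (#S : ℝ) / q - 1 / k = (#S * k - q) / (q * k) := by field_simp
    rw [h3, abs_div, abs_of_pos (mul_pos hq0 hk0), div_le_div_iff₀ (by positivity) hq0,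
      abs_of_nonpos (by linarith)]
    nlinarith
  have hdens : ((incidenceGraph φ S).edgeDensity A B : ℝ) * (s * s) =
      relSum (incidenceGraph φ S).Adj A B := by
    rw [relSum_eq_card_interedges, SimpleGraph.edgeDensity_def, hss]
    push_cast
    rw [div_mul_cancel₀ _ (by positivity)]
    rfl
  have hmain : |relSum (incidenceGraph φ S).Adj A B - 1 / k * (s * s)| ≤
      s * (√((q : ℝ) ^ 3) + 1 + q) := by
    have h1 := abs_relSum_incidenceGraph_sub_le (φ := φ) (S := S) A B
    have h2 := abs_relSum_incidenceRel_sub_le (φ := φ) (S := S) A B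
    have h3 : |((#S : ℝ) / q - 1 / k) * (s * s)| ≤ s * q := by
      rw [abs_mul, abs_of_pos (mul_pos hs0 hs0)]
      calc |(#S : ℝ) / q - 1 / k| * (s * s) ≤ 1 / q * (s * (q * q)) := by gcongr
        _ = s * q := by field_simp
    have h4 : relSum (incidenceGraph φ S).Adj A B - 1 / k * (s * s) =
        (relSum (incidenceGraph φ S).Adj A B - relSum (incidenceRel φ S) A B) +
        (relSum (incidenceRel φ S) A B - #S / q * #A * #B) +
        ((#S : ℝ) / q - 1 / k) * (s * s) := by
      rw [hss]; ring
    rw [h4]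
    refine (abs_add_three _ _ _).trans ?_
    linarith
  -- The left side is at most 3 q^(3/2), the right side is q^(9/5), and q ≥ 81 gives q^(3/10) ≥ 3.
  have hpow : √((q : ℝ) ^ 3) + 1 + q ≤ ((q * q : ℕ) : ℝ) ^ (9 / 10 : ℝ) := by
    have e1 : √((q : ℝ) ^ 3) = (q : ℝ) ^ (3 / 2 : ℝ) := by
      rw [Real.sqrt_eq_rpow, ← Real.rpow_natCast, ← Real.rpow_mul hq0.le]
      norm_num
    have e2 : (1 : ℝ) ≤ (q : ℝ) ^ (3 / 2 : ℝ) := Real.one_le_rpow (by linarith) (by norm_num)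
    have e3 : (q : ℝ) ≤ (q : ℝ) ^ (3 / 2 : ℝ) :=
      Real.self_le_rpow_of_one_le (by linarith) (by norm_num)
    have e4 : ((q * q : ℕ) : ℝ) ^ (9 / 10 : ℝ) = (q : ℝ) ^ (3 / 2 : ℝ) * (q : ℝ) ^ (3 / 10 : ℝ) := by
      rw [← Real.rpow_add hq0]
      push_cast
      rw [← sq, ← Real.rpow_natCast, ← Real.rpow_mul hq0.le]
      norm_num
    have e5 : (3 : ℝ) ≤ (q : ℝ) ^ (3 / 10 : ℝ) := by
      calc (3 : ℝ) = (81 : ℝ) ^ (1 / 4 : ℝ) := by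
            rw [show (81 : ℝ) = 3 ^ (4 : ℝ) by norm_num, ← Real.rpow_mul (by norm_num)]
            norm_num
        _ ≤ (q : ℝ) ^ (1 / 4 : ℝ) := by gcongr
        _ ≤ _ := Real.rpow_le_rpow_of_exponent_le (by linarith) (by norm_num)
    rw [e1, e4]
    nlinarith
  have hfin : |((incidenceGraph φ S).edgeDensity A B : ℝ) - 1 / k| * s ≤
      √((q : ℝ) ^ 3) + 1 + q := by
    rw [← hdens, ← sub_mul, abs_mul, abs_of_pos (mul_pos hs0 hs0)] at hmain
    refine le_of_mul_le_mul_left ?_ hs0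
    linarith
  rw [le_div_iff₀ hs0]
  have hfin' := hfin.trans hpow
  convert hfin' using 4

end Construction

/-! ### Bounds on induced Ramsey numbers. -/

section Bounds

open Finset

theorem exists_mem_inducedRamseySet_le {k d χ : ℕ} (hk : 2 ≤ k) (hd : 1 ≤ d) (hχ : 2 ≤ χ)
    {W : Type*} [Fintype W] {H : SimpleGraph W} (hW : Fintype.card W = k) (hH : IsDegenerate H d)
    (hc : H.chromaticNumber ≤ (χ : ℕ∞)) :
    ∃ n ∈ inducedRamseySet H, (n : ℝ) ≤ (k : ℝ) ^ (3000 * d * Real.logb 2 χ) := by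
  have hk0 : (2 : ℝ) ≤ k := by exact_mod_cast hk
  have hχ0 : (2 : ℝ) ≤ χ := by exact_mod_cast hχ
  have hd0 : (1 : ℝ) ≤ d := by exact_mod_cast hd
  have hL1 : 1 ≤ Real.logb 2 χ := by
    rw [Real.le_logb_iff_rpow_le (by norm_num) (by linarith)]
    simpa using hχ0
  set L := Real.logb 2 χ
  -- The pseudo-random theorem needs degeneracy at least 2; replacing d by d' ≤ 2d at most doubles
  -- the exponent to 2520 d log χ.
  set d' := max d 2 with hd'
  have hd'0 : (2 : ℝ) ≤ d' := by exact_mod_cast le_max_right d 2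
  have hd'1 : (d' : ℝ) ≤ 2 * d := by
    have : d' ≤ 2 * d := max_le (by omega) (by omega)
    exact_mod_cast this
  set X : ℝ := (k : ℝ) ^ (1260 * d' * L) with hX
  have hdL : 2 ≤ d' * L := by nlinarith
  have hX1 : (81 * 81 : ℝ) ≤ X := by
    calc (81 * 81 : ℝ) ≤ 2 ^ (13 : ℝ) := by norm_num
      _ ≤ (k : ℝ) ^ (13 : ℝ) := by gcongr
      _ ≤ X := Real.rpow_le_rpow_of_exponent_le (by linarith) (by linarith)
  have hX0 : 0 < X := by linarith
  set N := ⌈√X⌉₊ with hN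
  have hsX : 81 ≤ √X := by
    refine Real.le_sqrt_of_sq_le ?_
    linarith
  have hN1 : √X ≤ N := Nat.le_ceil _
  have hN2 : (N : ℝ) < √X + 1 := Nat.ceil_lt_add_one (by positivity)
  have hN0 : N ≠ 0 := by
    rintro h0
    rw [h0] at hN1
    norm_num at hN1
    linarith
  -- Bertrand's postulate: √X ≤ q ≤ 4√X, so q² is at least X and at most 16 X ≤ k^4 X.
  obtain ⟨q, hq, hNq, hq2⟩ := Nat.exists_prime_lt_and_le_two_mul N hN0
  have hNq' : (N : ℝ) ≤ q := by exact_mod_cast hNq.le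
  have hq2' : (q : ℝ) ≤ 2 * N := by exact_mod_cast hq2
  have hXX : √X * √X = X := Real.mul_self_sqrt hX0.le
  have hq81 : 81 ≤ q := by
    have : (81 : ℝ) ≤ q := by linarith
    exact_mod_cast this
  obtain ⟨G, hG⟩ := exists_isPseudoRandom (k := k) (by omega) hq hq81
  refine ⟨q * q, ⟨G, fun C => ?_⟩, ?_⟩
  · obtain ⟨i, hi⟩ := exists_color_of_isPseudoRandom hk (le_max_right d 2) hχ G (by
      rw [Fintype.card_fin, Nat.cast_mul]
      change X ≤ _
      rw [← hXX]
      exact mul_le_mul (hN1.trans hNq') (hN1.trans hNq') (by positivity) (by positivity)) (by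
      rwa [Fintype.card_fin]) C
    exact ⟨i, hi W H hW (hH.mono (le_max_left d 2)) hc⟩
  · push_cast
    have h1 : (q : ℝ) ≤ 4 * √X := by linarith
    calc (q : ℝ) * q ≤ (4 * √X) * (4 * √X) := by gcongr
      _ = 2 ^ (4 : ℝ) * X := by
          rw [show (4 * √X) * (4 * √X) = 16 * (√X * √X) by ring, hXX]; norm_num
      _ ≤ (k : ℝ) ^ (4 : ℝ) * X := by gcongr
      _ = (k : ℝ) ^ (4 + 1260 * d' * L) := by rw [hX, Real.rpow_add (by linarith)]
      _ ≤ _ := by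
          refine Real.rpow_le_rpow_of_exponent_le (by linarith) ?_
          have h2 := mul_le_mul_of_nonneg_right hd'1 (by linarith : 0 ≤ L)
          have h3 : 1 ≤ d * L := by nlinarith
          linarith

/-- Edgeless graphs are treated apart: the general bound requires k ≥ 2 and d ≥ 1, which follow once
H has an edge. -/
theorem card_mem_inducedRamseySet_bot {W : Type*} [Fintype W] :
    Fintype.card W ∈ inducedRamseySet (⊥ : SimpleGraph W) := by
  refine ⟨⊥, fun C => ⟨0, ⟨⟨(Fintype.equivFin W).toEmbedding, by simp⟩, fun a b h => ?_⟩⟩⟩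
  exact absurd h (by simp)

theorem IsDegenerate.one_le_of_ne_bot {W : Type*} [Fintype W] {H : SimpleGraph W} {d : ℕ}
    (h : IsDegenerate H d) (hne : H ≠ ⊥) : 1 ≤ d := by
  by_contra! hd
  obtain rfl : d = 0 := by omega
  exact hne (SimpleGraph.colorable_one_iff.1 h.colorable)

theorem two_le_card_of_ne_bot {W : Type*} [Fintype W] {H : SimpleGraph W} {k : ℕ}
    (hW : Fintype.card W = k) (hne : H ≠ ⊥) : 2 ≤ k := by
  by_contra! hk
  have : Subsingleton W := Fintype.card_le_one_iff_subsingleton.1 (by omega)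
  exact hne (Subsingleton.elim _ _)

end Bounds

theorem theorem1p4 :
    -- pseudo-random graphs have the induced Ramsey property, all copies in the same colour
    (∃ c : ℝ, 0 < c ∧ ∀ k d χ : ℕ, 2 ≤ k → 2 ≤ d → 2 ≤ χ →
      ∀ (V : Type u) [Fintype V] (G : SimpleGraph V),
        (k : ℝ) ^ (c * d * Real.logb 2 χ) ≤ (Fintype.card V : ℝ) →
        IsPseudoRandom G (1 / (k : ℝ)) ((Fintype.card V : ℝ) ^ (9 / 10 : ℝ)) →
        ∀ C : G.EdgeLabeling (Fin 2), ∃ i : Fin 2,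
          ∀ (W : Type v) [Fintype W] (H : SimpleGraph W), Fintype.card W = k →
            IsDegenerate H d → H.chromaticNumber ≤ (χ : ℕ∞) →
            HasInducedCopyInColor G C i H) ∧
    -- the induced Ramsey number exists and is at most `k ^ (c d log χ)`
    (∃ c : ℝ, 0 < c ∧ ∀ (k d χ : ℕ) (W : Type v) [Fintype W] (H : SimpleGraph W),
      Fintype.card W = k → IsDegenerate H d → H.chromaticNumber = (χ : ℕ∞) → 2 ≤ χ →
        (inducedRamseySet H).Nonempty ∧
        (inducedRamseyNumber H : ℝ) ≤ (k : ℝ) ^ (c * d * Real.logb 2 χ)) ∧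
    -- polynomial bound for bounded degeneracy
    (∀ d : ℕ, ∃ m : ℕ, ∀ (k : ℕ) (W : Type v) [Fintype W] (H : SimpleGraph W),
      Fintype.card W = k → IsDegenerate H d →
        (inducedRamseySet H).Nonempty ∧ inducedRamseyNumber H ≤ k ^ m) := by
  refine ⟨⟨1260, by norm_num, ?_⟩, ⟨3000, by norm_num, ?_⟩, ?_⟩
  · intro k d χ hk hd hχ V _ G hn hG C
    exact exists_color_of_isPseudoRandom hk hd hχ G hn hG C
  · intro k d χ W _ H hW hH hc hχ
    have hne : H ≠ ⊥ := by
      rw [← SimpleGraph.two_le_chromaticNumber_iff_ne_bot, hc]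
      exact_mod_cast hχ
    obtain ⟨n, hn, hle⟩ := exists_mem_inducedRamseySet_le (two_le_card_of_ne_bot hW hne)
      (hH.one_le_of_ne_bot hne) hχ hW hH hc.le
    refine ⟨⟨n, hn⟩, le_trans ?_ hle⟩
    exact_mod_cast Nat.sInf_le hn
  · intro d
    -- The maximum with 1 matters for d = 0, where the ceiling is 0 but the edgeless graph needs k
    -- vertices.
    refine ⟨max 1 ⌈3000 * d * Real.logb 2 ((d + 1 : ℕ) : ℝ)⌉₊, fun k W _ H hW hH => ?_⟩
    by_cases hbot : H = ⊥
    · subst hbot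
      have hmem : k ∈ inducedRamseySet (⊥ : SimpleGraph W) := hW ▸ card_mem_inducedRamseySet_bot
      exact ⟨⟨k, hmem⟩, (Nat.sInf_le hmem).trans (Nat.le_self_pow (by omega) k)⟩
    · have hk := two_le_card_of_ne_bot hW hbot
      have hd := hH.one_le_of_ne_bot hbot
      obtain ⟨n, hn, hle⟩ := exists_mem_inducedRamseySet_le hk hd (by omega : 2 ≤ d + 1) hW hH
        hH.colorable.chromaticNumber_le
      refine ⟨⟨n, hn⟩, (Nat.sInf_le hn).trans ?_⟩
      have hk1 : (1 : ℝ) ≤ k := by exact_mod_cast (by omega : 1 ≤ k)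
      have h : (n : ℝ) ≤ (k : ℝ) ^ (max 1 ⌈3000 * d * Real.logb 2 ((d + 1 : ℕ) : ℝ)⌉₊) := by
        refine hle.trans ?_
        rw [← Real.rpow_natCast]
        refine Real.rpow_le_rpow_of_exponent_le hk1 ((Nat.le_ceil _).trans ?_)
        exact_mod_cast le_max_right _ _
      exact_mod_cast h
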